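/- **Conventions.** Let $d\ge 0$ be an integer and let $(\Omega,\mathscr B,\mathbf P)$ be a probability space. The pairing $(\cdot,\cdot)$ of a tempered distribution with a test function is antilinear in the test function. For $f\in\mathscr S(\mathbf R^n)$, $$\widehat f(\xi)=(2\pi)^{-n/2}\int f(x)e^{-i\langle x,\xi\rangle}\,dx ,$$ and for $h\in\mathscr S'(\mathbf R^n)$ the distribution $\widehat h$ is defined by $(\widehat h,\widehat g)=(h,g)$. The symbol $\mathscr F_2$ denotes the partial Fourier transform, with the same normalization, in the second $n$ variables of $\mathbf R^{2n}$. Put $\kappa(x,y)=(x+\frac y2,\,x-\frac y2)$ and $$W(g,f)=\mathscr F_2\big((g\otimes\overline f)\circ\kappa\big)\in\mathscr S(\mathbf R^{2n}),\qquad f,g\in\mathscr S(\mathbf R^n).$$ A tempered generalized stochastic process (GSP) on $\mathbf R^n$ is a continuous conjugate linear map $v:\mathscr S(\mathbf R^n)\to L^2(\Omega)$. Its mean is $(\mathbf E v,\varphi)=\mathbf E(v,\varphi)$ and its covariance operator is given by $(\mathscr K_v\psi,\varphi)=\mathbf E\big((v,\varphi)\overline{(v,\psi)}\big)$. The Weyl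 symbol of $\mathscr K_v$ is the $\sigma\in\mathscr S'(\mathbf R^{2n})$ such that $(\mathscr K_v f,g)=(2\pi)^{-n/2}(\sigma,W(g,f))$ for all $f,g\in\mathscr S(\mathbf R^n)$. **Hypotheses.** Let $u$ be a tempered GSP on $\mathbf R^d$ with zero mean that is * symmetric: $\lambda u$ and $u$ have the same finite-dimensional distributions for all $\lambda\in\mathbf C$ with $|\lambda|=1$; * Gaussian: for all finitely many $\varphi_j\in\mathscr S(\mathbf R^d)$ the real and imaginary parts of the $(u,\varphi_j)$ are jointly Gaussian, possibly degenerate; * stationary: its mean is constant and $(\mathscr K_uT_x\psi,T_x\varphi)=(\mathscr K_u\psi,\varphi)$ for all $x\in\mathbf R^d$ and $\varphi,\psi\in\mathscr S(\mathbf R^d)$, where $T_x\varphi(y)=\varphi(y-x)$. Let the non-negative tempered measure $\mu_u$ on $\mathbf R^d$ be the spectral measure of $u$, that is, $\mu_u=(2\pi)^{d/2}\,\widehat{h_u}$, where $h_u\in\mathscr S'(\mathbf R^d)$ satisfies $\mathbf E\big((u,\varphi)\overline{(u,\psi)}\big)=(h_u,\varphi*\psi^*)$ for all $\varphi,\psi\in\mathscr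 S(\mathbf R^d)$, with $\psi^*(x)=\overline{\psi(-x)}$. **Conclusion.** 1. There is exactly one tempered GSP $U=u\otimes\overline u$ on $\mathbf R^{2d}$ such that $(U,\varphi\otimes\overline\psi)=(u,\varphi)\overline{(u,\psi)}$ for all $\varphi,\psi\in\mathscr S(\mathbf R^d)$. Put $U_0=U-\mathbf E U$. Define the Wigner distribution $W(u)$ and the zero mean Wigner distribution $W_0(u)$, both tempered GSPs on $\mathbf R^{2d}$, by $$(W(u),\Phi)=\big(U,(\mathscr F_2^{-1}\Phi)\circ\kappa^{-1}\big),\qquad (W_0(u),\Phi)=\big(U_0,(\mathscr F_2^{-1}\Phi)\circ\kappa^{-1}\big),\qquad \Phi\in\mathscr S(\mathbf R^{2d}).$$ 2. $\mathbf E W(u)=(2\pi)^{-d/2}\;1\otimes\mu_u$. 3. The covariance operator of $W_0(u)$ has exactly one Weyl symbol $\sigma_W\in\mathscr S'(\mathbf R^{4d})$, and $$\sigma_W(x_1,x_2,\xi_1,\xi_2)=\mu_u\big(x_2+\tfrac12\xi_1\big)\,\mu_u\big(x_2-\tfrac12\xi_1\big).$$ The right-hand side denotes the tempered distribution $(1\otimes\mu_u\otimes\mu_u\otimes1)\circ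 A$, where $A(x_1,x_2,\xi_1,\xi_2)=(x_1,\,x_2+\frac12\xi_1,\,x_2-\frac12\xi_1,\,\xi_2)$ and $(T\circ A,\Phi)=|\det A|^{-1}(T,\Phi\circ A^{-1})$. -/

import Mathlib

noncomputable section

open MeasureTheory SchwartzMap FourierTransform Module
open scoped ComplexConjugate RealInnerProductSpace

set_option linter.unusedSectionVars false
namespace PartialFourier
variable {V : Type} [NormedAddCommGroup V] [InnerProductSpace ℝ V] [FiniteDimensional ℝ V]
  [MeasurableSpace V] [BorelSpace V] {F : Type} [NormedAddCommGroup F] [NormedSpace ℂ F]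

/-- The integrand of the partial Fourier integral. -/
def integrand (f : 𝓢(V × V, F)) (p : V × V) (y : V) : F :=
  Real.fourierChar (-⟪y, p.2⟫) • f (p.1, y)

/-- The partial Fourier integral `∫ f(x, y) e^{-2πi⟨y,ξ⟩} dy` at `p = (x, ξ)`. -/
def raw (f : 𝓢(V × V, F)) (p : V × V) : F := ∫ y, integrand f p y

/-- The bilinear map `(v, y) ↦ ((a, b) ↦ -2πi ⟨y, b⟩ v)`. -/
def derivBilin (V F : Type) [NormedAddCommGroup V] [InnerProductSpace ℝ V]
    [NormedAddCommGroup F] [NormedSpace ℂ F] :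
    F →L[ℝ] V →L[ℝ] (V × V →L[ℝ] F) :=
  ((ContinuousLinearMap.smulRightL ℝ (V × V) F).comp
    (((ContinuousLinearMap.compL ℝ (V × V) V ℝ).flip (ContinuousLinearMap.snd ℝ V V)).comp
      (innerSL ℝ))).flip.comp ((-(2 * Real.pi * Complex.I)) • ContinuousLinearMap.id ℝ F)

theorem derivBilin_apply (v : F) (y : V) (q : V × V) :
    derivBilin V F v y q = ⟪y, q.2⟫ • ((-(2 * Real.pi * Complex.I)) • v) := by
  simp only [derivBilin, ContinuousLinearMap.comp_apply, ContinuousLinearMap.flip_apply,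
    smul_apply, ContinuousLinearMap.id_apply]
  simp

/-- The Schwartz map whose partial Fourier integral is the derivative of that of `f`. -/
def derivMap : 𝓢(V × V, F) →L[ℝ] 𝓢(V × V, V × V →L[ℝ] F) :=
  (postcompCLM (𝕜 := ℝ) ((ContinuousLinearMap.compL ℝ (V × V) (V × V) F).flip
    ((ContinuousLinearMap.inl ℝ V V).comp (ContinuousLinearMap.fst ℝ V V)))).comp
      (fderivCLM ℝ (V × V) F) +
  bilinLeftCLM (derivBilin V F) (ContinuousLinearMap.snd ℝ V V).hasTemperateGrowth

theorem derivMap_apply (f : 𝓢(V × V, F)) (z q : V × V) :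
    derivMap f z q = fderiv ℝ f z (q.1, 0) + ⟪z.2, q.2⟫ • ((-(2 * Real.pi * Complex.I)) • f z) := by
  simp [derivMap, derivBilin_apply]

theorem norm_integrand (f : 𝓢(V × V, F)) (p : V × V) (y : V) :
    ‖integrand f p y‖ = ‖f (p.1, y)‖ := by
  rw [integrand, Circle.norm_smul]

theorem bound_pow (f : 𝓢(V × V, F)) (k r : ℕ) (x y : V) :
    ‖x‖ ^ k * ‖f (x, y)‖ ≤ (1 + ‖y‖) ^ (-(r : ℝ)) *
      (2 ^ (k + r) * ((Finset.Iic (k + r, 0)).sup (schwartzSeminormFamily ℝ (V × V) F)) f) := by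
  have h := one_add_le_sup_seminorm_apply (𝕜 := ℝ) (m := (k + r, 0)) (k := k + r) (n := 0)
    le_rfl le_rfl f (x, y)
  rw [norm_iteratedFDeriv_zero] at h
  have hy : 0 < 1 + ‖y‖ := by positivity
  rw [Real.rpow_neg hy.le, Real.rpow_natCast, inv_mul_eq_div, le_div_iff₀ (by positivity)]
  refine le_trans ?_ h
  have h1 : ‖x‖ ≤ 1 + ‖(x, y)‖ := (norm_fst_le (x, y)).trans (by linarith)
  have h2 : 1 + ‖y‖ ≤ 1 + ‖(x, y)‖ := by linarith [norm_snd_le (x, y)]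
  calc ‖x‖ ^ k * ‖f (x, y)‖ * (1 + ‖y‖) ^ r = (‖x‖ ^ k * (1 + ‖y‖) ^ r) * ‖f (x, y)‖ := by ring
    _ ≤ ((1 + ‖(x, y)‖) ^ k * (1 + ‖(x, y)‖) ^ r) * ‖f (x, y)‖ := by gcongr
    _ = _ := by rw [pow_add]

theorem integrable_weight :
    Integrable (fun y : V => (1 + ‖y‖) ^ (-((finrank ℝ V + 1 : ℕ) : ℝ))) :=
  integrable_one_add_norm (by push_cast; linarith)

theorem continuous_integrand (f : 𝓢(V × V, F)) (p : V × V) : Continuous (integrand f p) := by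
  unfold integrand
  simp only [Circle.smul_def]
  have := f.continuous
  have h2 : Continuous Real.fourierChar := Real.continuous_fourierChar
  fun_prop

theorem integrable_integrand (f : 𝓢(V × V, F)) (p : V × V) : Integrable (integrand f p) := by
  refine (integrable_weight.mul_const (2 ^ (0 + (finrank ℝ V + 1)) *
    ((Finset.Iic (0 + (finrank ℝ V + 1), 0)).sup (schwartzSeminormFamily ℝ (V × V) F)) f)).mono'
    (continuous_integrand f p).aestronglyMeasurable (.of_forall fun y => ?_)
  rw [norm_integrand]
  simpa using bound_pow f 0 (finrank ℝ V + 1) p.1 y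

theorem hasFDerivAt_integrand (f : 𝓢(V × V, F)) (p : V × V) (y : V) :
    HasFDerivAt (fun q => integrand f q y) (integrand (F := V × V →L[ℝ] F) (derivMap f) p y) p := by
  have h1 : HasFDerivAt (fun q : V × V => f (q.1, y))
      ((fderiv ℝ f (p.1, y)).comp ((ContinuousLinearMap.fst ℝ V V).prod 0)) p := by
    have hb : HasFDerivAt (fun q : V × V => (q.1, y)) ((ContinuousLinearMap.fst ℝ V V).prod 0) p :=
      hasFDerivAt_fst.prodMk (hasFDerivAt_const y p)
    have ha : HasFDerivAt f (fderiv ℝ f (p.1, y)) ((fun q : V × V => (q.1, y)) p) :=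
      (f.differentiable (p.1, y)).hasFDerivAt
    exact HasFDerivAt.comp p ha hb
  have h2 : HasFDerivAt (fun q : V × V => (Real.fourierChar (-⟪y, q.2⟫) : ℂ))
      ((-(2 * Real.pi * Complex.I) * (Real.fourierChar (-⟪y, p.2⟫) : ℂ)) •
        (Complex.ofRealCLM.comp ((innerSL ℝ y).comp (ContinuousLinearMap.snd ℝ V V)))) p := by
    have ha : HasFDerivAt (fun q : V × V => -⟪y, q.2⟫)
        (-((innerSL ℝ y).comp (ContinuousLinearMap.snd ℝ V V))) p :=
      ((innerSL ℝ y).comp (ContinuousLinearMap.snd ℝ V V)).hasFDerivAt.neg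
    have hb : HasDerivAt (fun t : ℝ => (Real.fourierChar t : ℂ))
        (2 * Real.pi * Complex.I * (Real.fourierChar (-⟪y, p.2⟫) : ℂ))
        ((fun q : V × V => -⟪y, q.2⟫) p) := Real.hasDerivAt_fourierChar _
    have := HasFDerivAt.comp p hb.hasFDerivAt ha
    refine this.congr_fderiv ?_
    ext q <;> simp <;> ring
  have h3 := h2.smul h1
  refine (h3.congr_of_eventuallyEq (.of_forall fun q => ?_)).congr_fderiv ?_
  · simp [integrand, Circle.smul_def]
  · ext q <;> simp [integrand, Circle.smul_def, derivMap_apply, smul_add]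
    rw [← Complex.coe_smul, smul_smul, smul_smul]
    congr 1
    ring

theorem hasFDerivAt_raw (f : 𝓢(V × V, F)) (p : V × V) :
    HasFDerivAt (raw f) (raw (F := V × V →L[ℝ] F) (derivMap f) p) p := by
  refine hasFDerivAt_integral_of_dominated_of_fderiv_le (s := Set.univ) (F := integrand f)
    (F' := integrand (F := V × V →L[ℝ] F) (derivMap f)) Filter.univ_mem
    (.of_forall fun q => (continuous_integrand f q).aestronglyMeasurable)
    (integrable_integrand f p) (continuous_integrand _ p).aestronglyMeasurable
    (.of_forall fun y q _ => ?_) (integrable_weight.mul_const (2 ^ (0 + (finrank ℝ V + 1)) *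
      ((Finset.Iic (0 + (finrank ℝ V + 1), 0)).sup (schwartzSeminormFamily ℝ (V × V)
        (V × V →L[ℝ] F))) (derivMap f)))
    (.of_forall fun y q _ => hasFDerivAt_integrand f q y)
  · rw [norm_integrand]
    simpa using bound_pow (F := V × V →L[ℝ] F) (derivMap f) 0 (finrank ℝ V + 1) q.1 y

theorem fderiv_raw (f : 𝓢(V × V, F)) : fderiv ℝ (raw f) = raw (F := V × V →L[ℝ] F) (derivMap f) :=
  funext fun p => (hasFDerivAt_raw f p).fderiv

theorem contDiff_raw_nat (n : ℕ) : ∀ {F : Type} [NormedAddCommGroup F] [NormedSpace ℂ F]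
    (f : 𝓢(V × V, F)), ContDiff ℝ n (raw f) := by
  induction n with
  | zero =>
    intro F _ _ f
    have h : Differentiable ℝ (raw f) := fun p => (hasFDerivAt_raw f p).differentiableAt
    exact contDiff_zero.2 h.continuous
  | succ n ih =>
    intro F _ _ f
    push_cast
    rw [contDiff_succ_iff_fderiv]
    refine ⟨fun p => (hasFDerivAt_raw f p).differentiableAt, by simp, ?_⟩
    rw [fderiv_raw]
    exact ih _

theorem contDiff_raw (f : 𝓢(V × V, F)) : ContDiff ℝ (⊤ : ℕ∞) (raw f) :=
  contDiff_infty.2 fun n => contDiff_raw_nat n f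

theorem norm_iteratedFDeriv_slice_le (f : 𝓢(V × V, F)) (x y : V) (n : ℕ) :
    ‖iteratedFDeriv ℝ n (fun y => f (x, y)) y‖ ≤ ‖iteratedFDeriv ℝ n f (x, y)‖ := by
  have h0 : (fun y => f (x, y)) = (fun z => f ((x, 0) + z)) ∘ (ContinuousLinearMap.inr ℝ V V) := by
    ext y; simp
  have hs : ContDiff ℝ n (fun z => f ((x, 0) + z)) :=
    (f.smooth n).comp (contDiff_const.add contDiff_id)
  rw [h0, ContinuousLinearMap.iteratedFDeriv_comp_right _ hs _ le_rfl, iteratedFDeriv_comp_add_left]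
  refine (ContinuousMultilinearMap.norm_compContinuousLinearMap_le _ _).trans ?_
  have h1 : ∏ _i : Fin n, ‖ContinuousLinearMap.inr ℝ V V‖ ≤ 1 := by
    refine Finset.prod_le_one (fun _ _ => ContinuousLinearMap.opNorm_nonneg _) fun _ _ => ?_
    exact ContinuousLinearMap.opNorm_le_bound _ zero_le_one fun y => by simp
  refine (mul_le_of_le_one_right (norm_nonneg _) h1).trans (by simp)

theorem decay_slice (f : 𝓢(V × V, F)) (x y : V) (k n : ℕ) :
    ‖y‖ ^ k * ‖iteratedFDeriv ℝ n (fun y => f (x, y)) y‖ ≤ SchwartzMap.seminorm ℝ k n f := by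
  refine le_trans ?_ (f.le_seminorm ℝ k n (x, y))
  gcongr
  · exact norm_snd_le (x, y)
  · exact norm_iteratedFDeriv_slice_le f x y n

/-- The slice `y ↦ f (x, y)`. -/
def slice (f : 𝓢(V × V, F)) (x : V) : 𝓢(V, F) where
  toFun y := f (x, y)
  smooth' := f.smooth'.comp (contDiff_const.prodMk contDiff_id)
  decay' k n := ⟨_, fun y => decay_slice f x y k n⟩

theorem seminorm_slice_le (f : 𝓢(V × V, F)) (x : V) (m : ℕ × ℕ) :
    schwartzSeminormFamily ℝ V F m (slice f x) ≤ schwartzSeminormFamily ℝ (V × V) F m f :=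
  (slice f x).seminorm_le_bound ℝ m.1 m.2 (apply_nonneg _ _) fun y => decay_slice f x y m.1 m.2

theorem sup_seminorm_slice_le (f : 𝓢(V × V, F)) (x : V) (s : Finset (ℕ × ℕ)) :
    s.sup (schwartzSeminormFamily ℝ V F) (slice f x) ≤
      s.sup (schwartzSeminormFamily ℝ (V × V) F) f := by
  refine Seminorm.finset_sup_apply_le (apply_nonneg _ _) fun m hm => ?_
  exact (seminorm_slice_le f x m).trans (Seminorm.le_finset_sup_apply hm)

theorem raw_eq (f : 𝓢(V × V, F)) (p : V × V) : raw f p = 𝓕 (slice f p.1) p.2 := by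
  rw [fourier_coe, Real.fourier_eq]
  rfl

theorem bound_raw_fst (k : ℕ) : ∃ (s : Finset (ℕ × ℕ)) (C : ℝ), 0 ≤ C ∧
    ∀ (f : 𝓢(V × V, F)) (p : V × V), ‖p.1‖ ^ k * ‖raw f p‖ ≤
      C * s.sup (schwartzSeminormFamily ℝ (V × V) F) f := by
  set r := finrank ℝ V + 1 with hr
  refine ⟨Finset.Iic (k + r, 0), (∫ y : V, (1 + ‖y‖) ^ (-(r : ℝ))) * 2 ^ (k + r), by positivity,
    fun f p => ?_⟩
  have h1 : ‖p.1‖ ^ k * ‖raw f p‖ ≤ ∫ y, ‖p.1‖ ^ k * ‖integrand f p y‖ := by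
    rw [integral_const_mul]
    gcongr
    exact norm_integral_le_integral_norm _
  refine h1.trans ?_
  rw [mul_assoc, ← integral_mul_const]
  refine integral_mono ((integrable_integrand f p).norm.const_mul _)
    (integrable_weight.mul_const _) fun y => ?_
  simp only [norm_integrand]
  exact bound_pow f k r p.1 y

theorem bound_raw_snd (k : ℕ) : ∃ (s : Finset (ℕ × ℕ)) (C : ℝ), 0 ≤ C ∧
    ∀ (f : 𝓢(V × V, F)) (p : V × V), ‖p.2‖ ^ k * ‖raw f p‖ ≤
      C * s.sup (schwartzSeminormFamily ℝ (V × V) F) f := by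
  let q : Seminorm ℝ 𝓢(V, F) := (schwartzSeminormFamily ℝ V F (k, 0)).comp
    (fourierCLM ℝ 𝓢(V, F)).toLinearMap
  have hq : Continuous q := ((schwartz_withSeminorms ℝ V F).continuous_seminorm (k, 0)).comp
    (fourierCLM ℝ 𝓢(V, F)).continuous
  obtain ⟨s, C, -, h⟩ := Seminorm.bound_of_continuous (schwartz_withSeminorms ℝ V F) q hq
  refine ⟨s, C, C.2, fun f p => ?_⟩
  have h1 := (𝓕 (slice f p.1)).le_seminorm ℝ k 0 p.2
  rw [norm_iteratedFDeriv_zero, ← raw_eq] at h1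
  refine h1.trans ((h (slice f p.1)).trans ?_)
  change (C : ℝ) * _ ≤ _
  gcongr
  exact sup_seminorm_slice_le f p.1 s

theorem bound_raw (n : ℕ) : ∀ (F : Type) [NormedAddCommGroup F] [NormedSpace ℂ F] (k : ℕ),
    ∃ (s : Finset (ℕ × ℕ)) (C : ℝ), 0 ≤ C ∧ ∀ (f : 𝓢(V × V, F)) (p : V × V),
      ‖p‖ ^ k * ‖iteratedFDeriv ℝ n (raw f) p‖ ≤
        C * s.sup (schwartzSeminormFamily ℝ (V × V) F) f := by
  induction n with
  | zero =>
    intro F _ _ k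
    obtain ⟨s, C, hC, h⟩ := bound_raw_fst (V := V) (F := F) k
    obtain ⟨t, D, hD, h'⟩ := bound_raw_snd (V := V) (F := F) k
    refine ⟨s ∪ t, C + D, by positivity, fun f p => ?_⟩
    rw [norm_iteratedFDeriv_zero, add_mul]
    have hs : s.sup (schwartzSeminormFamily ℝ (V × V) F) f ≤
        (s ∪ t).sup (schwartzSeminormFamily ℝ (V × V) F) f :=
      Finset.sup_mono (f := schwartzSeminormFamily ℝ (V × V) F) Finset.subset_union_left f
    have ht : t.sup (schwartzSeminormFamily ℝ (V × V) F) f ≤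
        (s ∪ t).sup (schwartzSeminormFamily ℝ (V × V) F) f :=
      Finset.sup_mono (f := schwartzSeminormFamily ℝ (V × V) F) Finset.subset_union_right f
    have hp : ‖p‖ ^ k ≤ ‖p.1‖ ^ k + ‖p.2‖ ^ k := by
      rw [Prod.norm_def]
      rcases max_cases ‖p.1‖ ‖p.2‖ with h | h <;> (rw [h.1]; simp)
    calc ‖p‖ ^ k * ‖raw f p‖ ≤ (‖p.1‖ ^ k + ‖p.2‖ ^ k) * ‖raw f p‖ := by gcongr
      _ = ‖p.1‖ ^ k * ‖raw f p‖ + ‖p.2‖ ^ k * ‖raw f p‖ := add_mul _ _ _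
      _ ≤ C * s.sup (schwartzSeminormFamily ℝ (V × V) F) f +
          D * t.sup (schwartzSeminormFamily ℝ (V × V) F) f := add_le_add (h f p) (h' f p)
      _ ≤ _ := by gcongr
  | succ n ih =>
    intro F _ _ k
    obtain ⟨s, C, hC, h⟩ := ih (V × V →L[ℝ] F) k
    let q : Seminorm ℝ 𝓢(V × V, F) :=
      (s.sup (schwartzSeminormFamily ℝ (V × V) (V × V →L[ℝ] F))).comp
        (derivMap (V := V) (F := F)).toLinearMap
    have hs : Continuous (s.sup (schwartzSeminormFamily ℝ (V × V) (V × V →L[ℝ] F)) : Seminorm ℝ _) :=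
      Seminorm.continuous_finsetSup fun i _ =>
        (schwartz_withSeminorms ℝ (V × V) (V × V →L[ℝ] F)).continuous_seminorm i
    have hq : Continuous q := hs.comp (derivMap (V := V) (F := F)).continuous
    obtain ⟨t, D, -, h'⟩ := Seminorm.bound_of_continuous (schwartz_withSeminorms ℝ (V × V) F) q hq
    refine ⟨t, C * D, mul_nonneg hC D.2, fun f p => ?_⟩
    rw [← norm_iteratedFDeriv_fderiv, fderiv_raw, mul_assoc]
    refine (h (derivMap f) p).trans ?_
    gcongr
    exact h' f

theorem raw_add (f g : 𝓢(V × V, F)) (p : V × V) : raw (f + g) p = raw f p + raw g p := by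
  rw [raw, raw, raw, ← integral_add (integrable_integrand f p) (integrable_integrand g p)]
  exact integral_congr_ae (.of_forall fun y => by simp [integrand])

theorem raw_smul (c : ℂ) (f : 𝓢(V × V, F)) (p : V × V) : raw (c • f) p = c • raw f p := by
  rw [raw, raw, ← integral_smul]
  exact integral_congr_ae (.of_forall fun y => by
    simp only [integrand, IsSMulApply.smul_apply]
    exact smul_comm _ _ _)

/-- `raw` as a continuous linear map on the Schwartz space. -/
def rawCLM : 𝓢(V × V, ℂ) →L[ℂ] 𝓢(V × V, ℂ) :=
  mkCLM raw raw_add (fun c f p => raw_smul c f p) contDiff_raw fun n => by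
    obtain ⟨s, C, hC, h⟩ := bound_raw (V := V) n.2 ℂ n.1
    refine ⟨s, C, hC, fun f p => (h f p).trans_eq ?_⟩
    congr 1
    rw [Seminorm.finset_sup_apply, Seminorm.finset_sup_apply]
    rfl

end PartialFourier

namespace WignerProcess

/-- `V × V` with its Euclidean norm: the phase space `T^*V`, and `ℝ^{2n}` when `V = ℝ^n`. -/
abbrev Phase (V : Type) : Type := WithLp 2 (V × V)

/-- The point of `Phase V` with components `x` and `y`. -/
abbrev pt {V : Type} (x y : V) : Phase V := WithLp.toLp 2 (x, y)

section Analysis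

variable {V : Type} [NormedAddCommGroup V] [InnerProductSpace ℝ V] [FiniteDimensional ℝ V]
  [MeasurableSpace V] [BorelSpace V]

/-- Tempered distributions, acting *antilinearly* on Schwartz functions. -/
abbrev TD (V : Type) [NormedAddCommGroup V] [InnerProductSpace ℝ V] : Type := 𝓢(V, ℂ) →L⋆[ℂ] ℂ

/-- The constant `(2π)^{n/2}`, `n = dim V`. -/
def twoPiPow (V : Type) [NormedAddCommGroup V] [InnerProductSpace ℝ V] : ℂ :=
  (((2 * Real.pi) ^ ((finrank ℝ V : ℝ) / 2) : ℝ) : ℂ)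

/-- Dilation `x ↦ c x`. -/
def dilation (V : Type) [NormedAddCommGroup V] [InnerProductSpace ℝ V] [FiniteDimensional ℝ V]
    (c : ℝ) (hc : c ≠ 0) : V ≃L[ℝ] V :=
  (LinearEquiv.smulOfNeZero ℝ V c hc).toContinuousLinearEquiv

@[simp] theorem dilation_apply (c : ℝ) (hc : c ≠ 0) (x : V) : dilation V c hc x = c • x := rfl

theorem inv_two_pi_ne_zero : (2 * Real.pi)⁻¹ ≠ 0 := inv_ne_zero (by positivity)

/-- The Fourier transform `(2π)^{-n/2} ∫ f(x) e^{-i⟨x,ξ⟩} dx` on the Schwartz space. -/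
def fourierS : 𝓢(V, ℂ) →L[ℂ] 𝓢(V, ℂ) :=
  (twoPiPow V)⁻¹ • (compCLMOfContinuousLinearEquiv ℂ
    (dilation V (2 * Real.pi)⁻¹ inv_two_pi_ne_zero)).comp (fourierCLM ℂ 𝓢(V, ℂ))

/-- The inverse Fourier transform `(2π)^{-n/2} ∫ f(ξ) e^{i⟨x,ξ⟩} dξ` on the Schwartz space. -/
def fourierInvS : 𝓢(V, ℂ) →L[ℂ] 𝓢(V, ℂ) :=
  (twoPiPow V)⁻¹ • (compCLMOfContinuousLinearEquiv ℂ
    (dilation V (-(2 * Real.pi)⁻¹) (neg_ne_zero.2 inv_two_pi_ne_zero))).comp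
      (fourierCLM ℂ 𝓢(V, ℂ))

theorem fourierChar_eq_exp_neg (a : ℝ) :
    (Real.fourierChar (-((2 * Real.pi)⁻¹ * a)) : ℂ) = Complex.exp (-(Complex.I * a)) := by
  rw [Real.fourierChar_apply]
  congr 1
  push_cast
  have : (Real.pi : ℂ) ≠ 0 := by exact_mod_cast Real.pi_ne_zero
  field_simp

theorem fourierChar_eq_exp (a : ℝ) :
    (Real.fourierChar (-(-(2 * Real.pi)⁻¹ * a)) : ℂ) = Complex.exp (Complex.I * a) := by
  have := fourierChar_eq_exp_neg (-a)
  rw [mul_neg, ← neg_mul] at this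
  rw [this]
  push_cast
  ring_nf

theorem fourierS_apply (f : 𝓢(V, ℂ)) (ξ : V) :
    fourierS f ξ = (twoPiPow V)⁻¹ * ∫ x, f x * Complex.exp (-(Complex.I * (⟪x, ξ⟫ : ℝ))) := by
  simp only [fourierS, smul_apply, ContinuousLinearMap.comp_apply,
    compCLMOfContinuousLinearEquiv_apply, Function.comp_apply, dilation_apply, smul_eq_mul,
    fourierCLM_apply, fourier_coe, Real.fourier_eq, Circle.smul_def, inner_smul_right,
    fourierChar_eq_exp_neg]
  simp only [mul_comm]

theorem fourierInvS_apply (f : 𝓢(V, ℂ)) (x : V) :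
    fourierInvS f x = (twoPiPow V)⁻¹ * ∫ ξ, f ξ * Complex.exp (Complex.I * (⟪ξ, x⟫ : ℝ)) := by
  simp only [fourierInvS, smul_apply, ContinuousLinearMap.comp_apply,
    compCLMOfContinuousLinearEquiv_apply, Function.comp_apply, dilation_apply, smul_eq_mul,
    fourierCLM_apply, fourier_coe, Real.fourier_eq, Circle.smul_def, inner_smul_right,
    fourierChar_eq_exp]
  simp only [mul_comm]

/-- The Fourier transform of a tempered distribution: `(ĥ, g) = (h, 𝓕⁻¹ g)`. -/
def TD.fourier (h : TD V) : TD V := h.comp fourierInvS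

/-- Partial Fourier transform in the second variable with a dilated frequency variable. -/
def partialFourierAux (c : ℝ) (hc : c ≠ 0) : 𝓢(Phase V, ℂ) →L[ℂ] 𝓢(Phase V, ℂ) :=
  (twoPiPow V)⁻¹ • ((compCLMOfContinuousLinearEquiv ℂ
    ((WithLp.prodContinuousLinearEquiv 2 ℝ V V).trans
      ((ContinuousLinearEquiv.refl ℝ V).prodCongr (dilation V c hc)))).comp
    PartialFourier.rawCLM).comp
    (compCLMOfContinuousLinearEquiv ℂ (WithLp.prodContinuousLinearEquiv 2 ℝ V V).symm)

/-- The partial Fourier transform `𝓕₂` on `𝓢(V × V)` with respect to the second variable. -/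
def partialFourier : 𝓢(Phase V, ℂ) →L[ℂ] 𝓢(Phase V, ℂ) :=
  partialFourierAux (2 * Real.pi)⁻¹ inv_two_pi_ne_zero

/-- The inverse partial Fourier transform `𝓕₂⁻¹` on `𝓢(V × V)`. -/
def partialFourierInv : 𝓢(Phase V, ℂ) →L[ℂ] 𝓢(Phase V, ℂ) :=
  partialFourierAux (-(2 * Real.pi)⁻¹) (neg_ne_zero.2 inv_two_pi_ne_zero)

theorem partialFourierAux_apply (c : ℝ) (hc : c ≠ 0) (Φ : 𝓢(Phase V, ℂ)) (x ξ : V) :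
    partialFourierAux c hc Φ (pt x ξ) =
      (twoPiPow V)⁻¹ * ∫ y, (Real.fourierChar (-(c * ⟪y, ξ⟫)) : ℂ) * Φ (pt x y) := by
  simp only [partialFourierAux, smul_apply, ContinuousLinearMap.comp_apply,
    compCLMOfContinuousLinearEquiv_apply, Function.comp_apply, smul_eq_mul]
  congr 1
  refine integral_congr_ae (.of_forall fun y => ?_)
  simp [PartialFourier.integrand, Circle.smul_def, inner_smul_right]

theorem partialFourier_apply (Φ : 𝓢(Phase V, ℂ)) (x ξ : V) :
    partialFourier Φ (pt x ξ) =
      (twoPiPow V)⁻¹ * ∫ y, Φ (pt x y) * Complex.exp (-(Complex.I * (⟪y, ξ⟫ : ℝ))) := by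
  rw [partialFourier, partialFourierAux_apply]
  simp only [fourierChar_eq_exp_neg]
  simp only [mul_comm]

theorem partialFourierInv_apply (Φ : 𝓢(Phase V, ℂ)) (x y : V) :
    partialFourierInv Φ (pt x y) =
      (twoPiPow V)⁻¹ * ∫ ξ, Φ (pt x ξ) * Complex.exp (Complex.I * (⟪ξ, y⟫ : ℝ)) := by
  rw [partialFourierInv, partialFourierAux_apply]
  simp only [fourierChar_eq_exp]
  simp only [mul_comm]

/-- The linear change of variables `κ(x, y) = (x + y/2, x - y/2)`, with inverse
`κ⁻¹(x, y) = ((x + y)/2, x - y)`. -/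
def kappa (V : Type) [NormedAddCommGroup V] [InnerProductSpace ℝ V] [FiniteDimensional ℝ V] :
    Phase V ≃L[ℝ] Phase V :=
  LinearEquiv.toContinuousLinearEquiv
    { toFun := fun z => pt (z.fst + (1 / 2 : ℝ) • z.snd) (z.fst - (1 / 2 : ℝ) • z.snd)
      invFun := fun z => pt ((1 / 2 : ℝ) • (z.fst + z.snd)) (z.fst - z.snd)
      map_add' := fun z w => by
        apply WithLp.ofLp_injective 2
        ext <;> simp <;> module
      map_smul' := fun c z => by
        apply WithLp.ofLp_injective 2
        ext <;> simp <;> module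
      left_inv := fun z => by
        apply WithLp.ofLp_injective 2
        ext <;> simp <;> module
      right_inv := fun z => by
        apply WithLp.ofLp_injective 2
        ext <;> simp <;> module }

/-- Complex conjugation of a Schwartz function. -/
def conjS (f : 𝓢(V, ℂ)) : 𝓢(V, ℂ) :=
  postcompCLM (𝕜 := ℝ) (Complex.conjCLE : ℂ →L[ℝ] ℂ) f

theorem conjS_apply (f : 𝓢(V, ℂ)) (x : V) : conjS f x = conj (f x) := rfl

/-- The involution `ψ^*(x) = conj (ψ (-x))`. -/
def starS (ψ : 𝓢(V, ℂ)) : 𝓢(V, ℂ) :=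
  compCLMOfContinuousLinearEquiv ℂ (ContinuousLinearEquiv.neg ℝ) (conjS ψ)

theorem starS_apply (f : 𝓢(V, ℂ)) (x : V) : starS f x = conj (f (-x)) := rfl

/-- Convolution of Schwartz functions. -/
def convS (φ ψ : 𝓢(V, ℂ)) : 𝓢(V, ℂ) :=
  SchwartzMap.convolution (ContinuousLinearMap.mul ℂ ℂ) φ ψ

theorem convS_apply (φ ψ : 𝓢(V, ℂ)) (x : V) : convS φ ψ x = ∫ y, φ y * ψ (x - y) :=
  SchwartzMap.convolution_apply _ φ ψ x

theorem norm_iteratedFDeriv_comp_le_of_le_one {W : Type} [NormedAddCommGroup W] [NormedSpace ℝ W]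
    (φ : 𝓢(V, ℂ)) (L : W →L[ℝ] V) (hL : ‖L‖ ≤ 1) (n : ℕ) (z : W) :
    ‖iteratedFDeriv ℝ n (fun z => φ (L z)) z‖ ≤ ‖iteratedFDeriv ℝ n φ (L z)‖ := by
  have h := L.iteratedFDeriv_comp_right (φ.smooth n) z le_rfl
  rw [Function.comp_def] at h
  rw [h]
  refine (ContinuousMultilinearMap.norm_compContinuousLinearMap_le _ _).trans ?_
  refine mul_le_of_le_one_right (norm_nonneg _) ?_
  exact Finset.prod_le_one (fun _ _ => norm_nonneg _) fun _ _ => hL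

theorem one_add_norm_le (z : Phase V) : 1 + ‖z‖ ≤ (1 + ‖z.fst‖) * (1 + ‖z.snd‖) := by
  have h : ‖z‖ ≤ ‖z.fst‖ + ‖z.snd‖ := by
    rw [WithLp.prod_norm_eq_of_L2]
    refine Real.sqrt_le_iff.2 ⟨by positivity, ?_⟩
    nlinarith [norm_nonneg z.fst, norm_nonneg z.snd]
  nlinarith [norm_nonneg z.fst, norm_nonneg z.snd, mul_nonneg (norm_nonneg z.fst) (norm_nonneg z.snd)]

theorem decay_tensor (φ ψ : 𝓢(V, ℂ)) (k n : ℕ) : ∃ C : ℝ, ∀ z : Phase V,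
    ‖z‖ ^ k * ‖iteratedFDeriv ℝ n (fun z : Phase V => φ z.fst * ψ z.snd) z‖ ≤ C := by
  let B (f : 𝓢(V, ℂ)) : ℝ :=
    2 ^ k * ((Finset.Iic (k, n)).sup fun m => SchwartzMap.seminorm ℝ m.1 m.2) f
  have hB (f : 𝓢(V, ℂ)) (i : ℕ) (hi : i ≤ n) (x : V) :
      (1 + ‖x‖) ^ k * ‖iteratedFDeriv ℝ i f x‖ ≤ B f :=
    one_add_le_sup_seminorm_apply (𝕜 := ℝ) (m := (k, n)) le_rfl hi f x
  have hf1 : ‖WithLp.fstL 2 ℝ V V‖ ≤ 1 :=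
    ContinuousLinearMap.opNorm_le_bound _ zero_le_one fun z => by
      simpa using WithLp.norm_fst_le _ z
  have hs1 : ‖WithLp.sndL 2 ℝ V V‖ ≤ 1 :=
    ContinuousLinearMap.opNorm_le_bound _ zero_le_one fun z => by
      simpa using WithLp.norm_snd_le _ z
  refine ⟨∑ i ∈ Finset.range (n + 1), (n.choose i : ℝ) * B φ * B ψ, fun z => ?_⟩
  have h1 := norm_iteratedFDeriv_mul_le (𝕜 := ℝ) (N := n)
    (f := fun z : Phase V => φ (WithLp.fstL 2 ℝ V V z))
    (g := fun z : Phase V => ψ (WithLp.sndL 2 ℝ V V z))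
    ((φ.smooth n).comp (WithLp.fstL 2 ℝ V V).contDiff)
    ((ψ.smooth n).comp (WithLp.sndL 2 ℝ V V).contDiff) z (n := n) le_rfl
  have hz : ‖z‖ ^ k ≤ (1 + ‖z.fst‖) ^ k * (1 + ‖z.snd‖) ^ k := by
    rw [← mul_pow]
    gcongr
    linarith [one_add_norm_le z]
  refine (mul_le_mul hz h1 (norm_nonneg _) (by positivity)).trans ?_
  rw [Finset.mul_sum]
  refine Finset.sum_le_sum fun i hi => ?_
  have hin : i ≤ n := by
    rw [Finset.mem_range] at hi
    omega
  have ha := norm_iteratedFDeriv_comp_le_of_le_one φ _ hf1 i z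
  have hb := norm_iteratedFDeriv_comp_le_of_le_one ψ _ hs1 (n - i) z
  have hc := hB φ i hin z.fst
  have hd := hB ψ (n - i) (Nat.sub_le _ _) z.snd
  have hB0 : 0 ≤ B φ := by positivity
  calc _ ≤ (1 + ‖z.fst‖) ^ k * (1 + ‖z.snd‖) ^ k * ((n.choose i : ℝ) *
        ‖iteratedFDeriv ℝ i φ z.fst‖ * ‖iteratedFDeriv ℝ (n - i) ψ z.snd‖) := by
        gcongr
        · exact ha
        · exact hb
    _ = (n.choose i : ℝ) * ((1 + ‖z.fst‖) ^ k * ‖iteratedFDeriv ℝ i φ z.fst‖) *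
        ((1 + ‖z.snd‖) ^ k * ‖iteratedFDeriv ℝ (n - i) ψ z.snd‖) := by ring
    _ ≤ _ := by gcongr

/-- The tensor product `(φ ⊗ ψ)(x, y) = φ(x) ψ(y)` of Schwartz functions. -/
def tensor (φ ψ : 𝓢(V, ℂ)) : 𝓢(Phase V, ℂ) where
  toFun z := φ z.fst * ψ z.snd
  smooth' := (φ.smooth'.comp (WithLp.fstL 2 ℝ V V).contDiff).mul
    (ψ.smooth'.comp (WithLp.sndL 2 ℝ V V).contDiff)
  decay' k n := decay_tensor φ ψ k n

theorem tensor_apply (φ ψ : 𝓢(V, ℂ)) (x y : V) : tensor φ ψ (pt x y) = φ x * ψ y := rfl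

/-- The cross-Wigner distribution `W(g, f) = 𝓕₂ ((g ⊗ conj f) ∘ κ)` of Schwartz functions. -/
def crossWigner (g f : 𝓢(V, ℂ)) : 𝓢(Phase V, ℂ) :=
  partialFourier (compCLMOfContinuousLinearEquiv ℂ (kappa V) (tensor g (conjS f)))

theorem crossWigner_apply (g f : 𝓢(V, ℂ)) (x ξ : V) :
    crossWigner g f (pt x ξ) = (twoPiPow V)⁻¹ * ∫ y, g (x + (1 / 2 : ℝ) • y) *
      conj (f (x - (1 / 2 : ℝ) • y)) * Complex.exp (-(Complex.I * (⟪y, ξ⟫ : ℝ))) :=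
  partialFourier_apply _ x ξ

/-- Composition `T ∘ A` of a tempered distribution with a linear automorphism:
`(T ∘ A, Φ) = |det A|⁻¹ (T, Φ ∘ A⁻¹)`. -/
def TD.compLinear (T : TD V) (A : V ≃L[ℝ] V) : TD V :=
  ((|LinearMap.det (A : V →ₗ[ℝ] V)|⁻¹ : ℝ) : ℂ) •
    T.comp (compCLMOfContinuousLinearEquiv ℂ A.symm)

/-- A tempered measure `ν` as a tempered distribution: `(ν, Φ) = ∫ conj Φ dν`. -/
def TD.ofMeasure (ν : Measure V) [ν.HasTemperateGrowth] : TD V :=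
  (starL ℂ : ℂ ≃L⋆[ℂ] ℂ).toContinuousLinearMap.comp (integralCLM ℂ ν)

theorem TD.ofMeasure_apply (ν : Measure V) [ν.HasTemperateGrowth] (Φ : 𝓢(V, ℂ)) :
    TD.ofMeasure ν Φ = ∫ x, conj (Φ x) ∂ν :=
  integral_conj.symm

/-- The product measure `ν₁ ⊗ ν₂` on `V × V`. -/
def prodMeasure (ν₁ ν₂ : Measure V) : Measure (Phase V) :=
  (ν₁.prod ν₂).map (WithLp.toLp 2)

theorem sigmaFinite_of_hasTemperateGrowth (ν : Measure V) [ν.HasTemperateGrowth] :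
    SigmaFinite ν := by
  have h := Measure.integrable_pow_neg_integrablePower ν
  have : IsLocallyFiniteMeasure ν := by
    refine ⟨fun x => ⟨Metric.ball x 1, Metric.ball_mem_nhds x one_pos, ?_⟩⟩
    have hc : (0 : ℝ) < (1 + (‖x‖ + 1)) ^ (-(ν.integrablePower : ℝ)) := by positivity
    refine lt_of_le_of_lt (measure_mono fun y hy => ?_) (h.measure_norm_ge_lt_top hc)
    have hy' : ‖y‖ ≤ ‖x‖ + 1 := by
      have h1 : ‖y - x‖ < 1 := by simpa [dist_eq_norm] using hy
      linarith [norm_le_norm_add_norm_sub' y x]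
    have hp : 0 < 1 + ‖y‖ := by positivity
    simp only [Set.mem_ofPred_eq]
    rw [Real.norm_of_nonneg (by positivity)]
    exact Real.rpow_le_rpow_of_nonpos hp (by linarith) (by simp)
  infer_instance

instance prodMeasure.hasTemperateGrowth (ν₁ ν₂ : Measure V) [ν₁.HasTemperateGrowth]
    [ν₂.HasTemperateGrowth] : (prodMeasure ν₁ ν₂).HasTemperateGrowth := by
  have := sigmaFinite_of_hasTemperateGrowth ν₁
  have := sigmaFinite_of_hasTemperateGrowth ν₂
  set a := ν₁.integrablePower
  set b := ν₂.integrablePower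
  refine ⟨a + b, ?_⟩
  have hm : MeasurableEmbedding (WithLp.toLp 2 : V × V → Phase V) :=
    (MeasurableEquiv.toLp 2 (V × V)).measurableEmbedding
  rw [prodMeasure, hm.integrable_map_iff]
  refine ((Measure.integrable_pow_neg_integrablePower ν₁).mul_prod
    (Measure.integrable_pow_neg_integrablePower ν₂)).mono' ?_ (.of_forall fun z => ?_)
  · have : Measurable (fun z : Phase V => (1 + ‖z‖) ^ (-((a + b : ℕ) : ℝ))) := by fun_prop
    exact (this.comp hm.measurable).aestronglyMeasurable
  · have h1 : 0 < 1 + ‖z.1‖ := by positivity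
    have h2 : 0 < 1 + ‖z.2‖ := by positivity
    have h3 : 1 + ‖z.1‖ ≤ 1 + ‖(WithLp.toLp 2 z : Phase V)‖ := by
      have h := WithLp.norm_fst_le _ (WithLp.toLp 2 z : Phase V)
      change ‖z.1‖ ≤ _ at h
      linarith
    have h4 : 1 + ‖z.2‖ ≤ 1 + ‖(WithLp.toLp 2 z : Phase V)‖ := by
      have h := WithLp.norm_snd_le _ (WithLp.toLp 2 z : Phase V)
      change ‖z.2‖ ≤ _ at h
      linarith
    have h5 : 0 < 1 + ‖(WithLp.toLp 2 z : Phase V)‖ := by positivity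
    simp only [Function.comp_apply]
    rw [Real.norm_of_nonneg (by positivity), Real.rpow_neg h5.le, Real.rpow_neg h1.le,
      Real.rpow_neg h2.le, Real.rpow_natCast, Real.rpow_natCast, Real.rpow_natCast, pow_add,
      mul_inv]
    gcongr

/-- `σ` is the Weyl symbol of the operator `K` from Schwartz functions to tempered distributions:
`(K f, g) = (2π)^{-n/2} (σ, W(g, f))` for all Schwartz functions `f`, `g`. -/
def IsWeylSymbol (K : 𝓢(V, ℂ) → TD V) (σ : TD (Phase V)) : Prop :=
  ∀ f g : 𝓢(V, ℂ), K f g = (twoPiPow V)⁻¹ * σ (crossWigner g f)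

end Analysis

section Processes

variable {V : Type} [NormedAddCommGroup V] [InnerProductSpace ℝ V] [FiniteDimensional ℝ V]
  [MeasurableSpace V] [BorelSpace V]
  {Ω : Type*} [MeasurableSpace Ω] {P : Measure Ω} [IsProbabilityMeasure P]

/-- Tempered generalized stochastic processes on `V`: continuous conjugate linear maps from the
Schwartz space to the space of complex square integrable random variables. -/
abbrev GSP (V : Type) [NormedAddCommGroup V] [InnerProductSpace ℝ V] {Ω : Type*}
    [MeasurableSpace Ω] (P : Measure Ω) : Type _ :=
  𝓢(V, ℂ) →L⋆[ℂ] Lp ℂ 2 P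

/-- The expectation on square integrable random variables. -/
def expect (P : Measure Ω) [IsProbabilityMeasure P] : Lp ℂ 2 P →L[ℂ] ℂ :=
  innerSL ℂ (Lp.const 2 P (1 : ℂ))

theorem expect_apply (X : Lp ℂ 2 P) : expect P X = ∫ ω, X ω ∂P := by
  rw [expect, innerSL_apply_apply, L2.inner_def]
  refine integral_congr_ae ?_
  filter_upwards [Lp.coeFn_const (p := 2) (μ := P) (1 : ℂ)] with ω hω
  simp

/-- The mean `(m_u, φ) = E (u, φ)`. -/
def mean (u : GSP V P) : TD V := (expect P).comp u

/-- The covariance operator `(K_u ψ, φ) = E ((u, φ) conj (u, ψ))`. -/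
def covOp (u : GSP V P) (ψ : 𝓢(V, ℂ)) : TD V := (innerSL ℂ (u ψ)).comp u

theorem covOp_apply (u : GSP V P) (ψ φ : 𝓢(V, ℂ)) :
    covOp u ψ φ = ∫ ω, u φ ω * conj (u ψ ω) ∂P := by
  rw [covOp, ContinuousLinearMap.comp_apply, innerSL_apply_apply, L2.inner_def]
  rfl

/-- `u` is Gaussian: for all finitely many test functions, the real and imaginary parts of the
variables `(u, φ_j)` are jointly Gaussian (possibly degenerate). -/
def IsGaussianGSP (u : GSP V P) : Prop :=
  ProbabilityTheory.IsGaussianProcess (fun (φ : 𝓢(V, ℂ)) (ω : Ω) => (u φ ω : ℂ)) P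

/-- `u` is symmetric: `c u` and `u` have the same finite dimensional distributions whenever
`|c| = 1`. -/
def IsSymmetricGSP (u : GSP V P) : Prop :=
  ∀ c : ℂ, ‖c‖ = 1 → ∀ (n : ℕ) (φ : Fin n → 𝓢(V, ℂ)),
    P.map (fun ω i => c * u (φ i) ω) = P.map (fun ω i => u (φ i) ω)

/-- `u` is stationary: its mean is constant and its covariance is translation invariant. -/
def IsStationaryGSP (u : GSP V P) : Prop :=
  (∃ c : ℂ, mean u = c • TD.ofMeasure volume) ∧
  ∀ (x : V) (φ ψ : 𝓢(V, ℂ)),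
    covOp u (compSubConstCLM ℂ x ψ) (compSubConstCLM ℂ x φ) = covOp u ψ φ

/-- `μ` is the spectral measure of the stationary process `u`: `μ = (2π)^{n/2} ĥ`, where `h` is
the tempered distribution such that `E ((u, φ) conj (u, ψ)) = (h, φ * ψ^*)`. -/
def IsSpectralMeasure (u : GSP V P) (μ : Measure V) [μ.HasTemperateGrowth] : Prop :=
  ∃ h : TD V, (∀ φ ψ : 𝓢(V, ℂ), covOp u ψ φ = h (convS φ (starS ψ))) ∧
    TD.ofMeasure μ = twoPiPow V • h.fourier

/-- `U` is the process `u ⊗ conj u` on `V × V`: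
`(U, φ ⊗ conj ψ) = (u, φ) conj (u, ψ)` for all Schwartz functions `φ`, `ψ`. -/
def IsTensorSquare (u : GSP V P) (U : GSP (Phase V) P) : Prop :=
  ∀ φ ψ : 𝓢(V, ℂ), U (tensor φ (conjS ψ)) =ᵐ[P] fun ω => u φ ω * conj (u ψ ω)

/-- `u - E u`. -/
def centered (u : GSP V P) : GSP V P :=
  u - (Lp.constL 2 P ℂ).comp (mean u)

/-- The Wigner transform of a process `U` on `V × V`:
`Φ ↦ (U, (𝓕₂⁻¹ Φ) ∘ κ⁻¹)`. For `U = u ⊗ conj u` this is the Wigner distribution `W(u)`; for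
`U = u ⊗ conj u - E (u ⊗ conj u)` this is the zero mean Wigner distribution `W₀(u)`. -/
def wigner (U : GSP (Phase V) P) : GSP (Phase V) P :=
  U.comp ((compCLMOfContinuousLinearEquiv ℂ (kappa V).symm).comp partialFourierInv)

end Processes

/-- The linear map `(x₁, x₂, ξ₁, ξ₂) ↦ (x₁, x₂ + ξ₁/2, x₂ - ξ₁/2, ξ₂)`. -/
def symbolMap (V : Type) [NormedAddCommGroup V] [InnerProductSpace ℝ V]
    [FiniteDimensional ℝ V] : Phase (Phase V) ≃L[ℝ] Phase (Phase V) :=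
  LinearEquiv.toContinuousLinearEquiv
    { toFun := fun z => pt (pt z.fst.fst (z.fst.snd + (1 / 2 : ℝ) • z.snd.fst))
        (pt (z.fst.snd - (1 / 2 : ℝ) • z.snd.fst) z.snd.snd)
      invFun := fun z => pt (pt z.fst.fst ((1 / 2 : ℝ) • (z.fst.snd + z.snd.fst)))
        (pt (z.fst.snd - z.snd.fst) z.snd.snd)
      map_add' := fun z w => by
        apply WithLp.ofLp_injective 2
        refine Prod.ext ?_ ?_ <;> apply WithLp.ofLp_injective 2 <;> ext <;> simp <;> module
      map_smul' := fun c z => by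
        apply WithLp.ofLp_injective 2
        refine Prod.ext ?_ ?_ <;> apply WithLp.ofLp_injective 2 <;> ext <;> simp <;> module
      left_inv := fun z => by
        apply WithLp.ofLp_injective 2
        refine Prod.ext ?_ ?_ <;> apply WithLp.ofLp_injective 2 <;> ext <;> simp <;> module
      right_inv := fun z => by
        apply WithLp.ofLp_injective 2
        refine Prod.ext ?_ ?_ <;> apply WithLp.ofLp_injective 2 <;> ext <;> simp <;> module }

end WignerProcess

end

open MeasureTheory WignerProcess

noncomputable section

open MeasureTheory SchwartzMap FourierTransform Module
open scoped ComplexConjugate RealInnerProductSpace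

set_option linter.unusedSectionVars false

/-! Everything is transported to `L²(μ ⊗ μ)`. Unwinding the spectral measure gives `E((u,φ) conj
(u,ψ)) = ∫ conj φ̂ · ψ̂ dμ` (`covOp_eq_integral`). For a centered Gaussian process, Wick's formula
writes a fourth moment as a sum over three pairings. Symmetry with `λ = i` kills `E((u,φ)(u,ψ))`,
and centering removes one more pairing. So the covariance of the centered products `(u,φ) conj
(u,ψ)` is a product of two covariances, that is, an inner product in `L²(μ ⊗ μ)` of the functions
`F̂(ξ, -η)` with `F = φ ⊗ conj ψ` (`inner_productVar_sub_expect_eq`).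

Existence of `U` follows from this Gram identity: two families of vectors with the same Gram matrix
are linked by a bounded linear map (`exists_clm_of_inner_eq`). Applying that map to the conjugate of
`F̂(ξ, -η)`, which depends continuously on `F`, and adding the mean gives a continuous process.
Uniqueness, and the passage of every identity from tensors to arbitrary Schwartz functions, rest on
the density of the span of the tensors (`topologicalClosure_span_tensor`, `ext_of_tensor`).

For the Wigner distribution, `F = (𝓕₂⁻¹ Φ) ∘ κ⁻¹`, and then `F̂(ξ, -η)` is the partial Fourier
transform of `Φ` in its first variable at `(ξ - η, (ξ + η)/2)`. On the diagonal `ξ = η` this gives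
the mean `1 ⊗ μ`. In the covariance, the coordinates `x₂ = (ξ + η)/2` and `ξ₁ = ξ - η` are those
that `A` undoes, and the two marginals of the cross-Wigner distribution identify the inner product
with the pairing of `(1 ⊗ μ ⊗ μ ⊗ 1) ∘ A` and `W(g, f)` (`symbolTD_crossWigner`). The symbol is
unique because cross-Wigner distributions are images of tensors under a surjective continuous linear
map (`ext_of_crossWigner`). -/

namespace WignerProcess

/-! ### Continuity of translations in the Schwartz topology. -/

section Translation

variable {W : Type} [NormedAddCommGroup W] [NormedSpace ℝ W]

theorem norm_pow_mul_iteratedFDeriv_sub_le (f : 𝓢(W, ℂ)) (k n : ℕ) (x w : W) :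
    ‖x‖ ^ k * ‖iteratedFDeriv ℝ n f (x - w)‖ ≤
      2 ^ k * (SchwartzMap.seminorm ℂ k n f + ‖w‖ ^ k * SchwartzMap.seminorm ℂ 0 n f) := by
  have h1 : ‖x‖ ^ k ≤ 2 ^ k * (‖x - w‖ ^ k + ‖w‖ ^ k) := by
    have hx : ‖x‖ ≤ ‖x - w‖ + ‖w‖ := by simpa using norm_add_le (x - w) w
    calc ‖x‖ ^ k ≤ (‖x - w‖ + ‖w‖) ^ k := by gcongr
      _ ≤ 2 ^ (k - 1) * (‖x - w‖ ^ k + ‖w‖ ^ k) := add_pow_le (norm_nonneg _) (norm_nonneg _) k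
      _ ≤ _ := by gcongr <;> simp
  have h2 := f.le_seminorm ℂ k n (x - w)
  have h3 := f.le_seminorm ℂ 0 n (x - w)
  rw [pow_zero, one_mul] at h3
  calc _ ≤ 2 ^ k * (‖x - w‖ ^ k + ‖w‖ ^ k) * ‖iteratedFDeriv ℝ n f (x - w)‖ := by gcongr
    _ = 2 ^ k * (‖x - w‖ ^ k * ‖iteratedFDeriv ℝ n f (x - w)‖ +
        ‖w‖ ^ k * ‖iteratedFDeriv ℝ n f (x - w)‖) := by ring
    _ ≤ _ := by gcongr

theorem iteratedFDeriv_compSubConstCLM (f : 𝓢(W, ℂ)) (n : ℕ) (w x : W) :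
    iteratedFDeriv ℝ n (compSubConstCLM ℂ w f) x = iteratedFDeriv ℝ n f (x - w) :=
  iteratedFDeriv_comp_sub n w x

theorem seminorm_compSubConstCLM_le (f : 𝓢(W, ℂ)) (k n : ℕ) (w : W) :
    SchwartzMap.seminorm ℂ k n (compSubConstCLM ℂ w f) ≤
      2 ^ k * (SchwartzMap.seminorm ℂ k n f + ‖w‖ ^ k * SchwartzMap.seminorm ℂ 0 n f) :=
  seminorm_le_bound ℂ k n _ (by positivity) fun x => by
    rw [iteratedFDeriv_compSubConstCLM]
    exact norm_pow_mul_iteratedFDeriv_sub_le f k n x w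

/-- Mean value inequality along the segment from `x` to `x - h`, at the cost of one more derivative.
The trailing factor `‖h‖` is what yields continuity at `h = 0`. -/
theorem seminorm_compSubConstCLM_sub_le (f : 𝓢(W, ℂ)) (k n : ℕ) (h : W) :
    SchwartzMap.seminorm ℂ k n (compSubConstCLM ℂ h f - f) ≤
      2 ^ k * (SchwartzMap.seminorm ℂ k (n + 1) f +
        ‖h‖ ^ k * SchwartzMap.seminorm ℂ 0 (n + 1) f) * ‖h‖ := by
  refine seminorm_le_bound ℂ k n _ (by positivity) fun x => ?_
  have hd : iteratedFDeriv ℝ n (compSubConstCLM ℂ h f - f : 𝓢(W, ℂ)) x =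
      iteratedFDeriv ℝ n f (x - h) - iteratedFDeriv ℝ n f x := by
    rw [← iteratedFDeriv_compSubConstCLM]
    exact iteratedFDeriv_sub_apply ((compSubConstCLM ℂ h f).contDiffAt n) (f.contDiffAt n)
  have hdiff (y : W) : DifferentiableAt ℝ (fun y => ‖x‖ ^ k • iteratedFDeriv ℝ n f y) y :=
    DifferentiableAt.fun_const_smul (((f.smooth (n + 1 : ℕ)).differentiable_iteratedFDeriv
      (by exact_mod_cast n.lt_succ_self)) y) _
  -- The weight `‖x‖ ^ k` is frozen at the endpoint `x`, so that only `D^n f` is differentiated.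
  -- Writing a point of the segment as `y = x - (x - y)` with `‖x - y‖ ≤ ‖h‖` lets the translation
  -- bound control it.
  have hmv := (convex_segment x (x - h)).norm_image_sub_le_of_norm_fderiv_le (𝕜 := ℝ)
    (f := fun y => ‖x‖ ^ k • iteratedFDeriv ℝ n f y)
    (C := 2 ^ k * (SchwartzMap.seminorm ℂ k (n + 1) f +
        ‖h‖ ^ k * SchwartzMap.seminorm ℂ 0 (n + 1) f)) (fun y _ => hdiff y) (fun y hy => ?_)
    (left_mem_segment ℝ _ _) (right_mem_segment ℝ _ _)
  · rw [hd]
    rw [← smul_sub, norm_smul, norm_pow, norm_norm] at hmv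
    simpa using hmv
  · rw [fderiv_fun_const_smul (((f.smooth (n + 1 : ℕ)).differentiable_iteratedFDeriv
      (by exact_mod_cast n.lt_succ_self)) y), norm_smul, norm_pow, norm_norm,
      norm_fderiv_iteratedFDeriv]
    have hyx : ‖x - y‖ ≤ ‖h‖ := by
      have := norm_sub_le_of_mem_segment hy
      rw [norm_sub_rev]
      simpa using this
    have := norm_pow_mul_iteratedFDeriv_sub_le f k (n + 1) x (x - y)
    rw [sub_sub_cancel] at this
    refine this.trans ?_
    gcongr

theorem tendsto_compSubConstCLM_zero (f : 𝓢(W, ℂ)) :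
    Filter.Tendsto (fun h : W => compSubConstCLM ℂ h f) (nhds 0) (nhds f) := by
  rw [(schwartz_withSeminorms ℂ W ℂ).tendsto_nhds _ f]
  rintro ⟨k, n⟩ ε hε
  have hc : Continuous fun h : W => 2 ^ k * (SchwartzMap.seminorm ℂ k (n + 1) f +
        ‖h‖ ^ k * SchwartzMap.seminorm ℂ 0 (n + 1) f) * ‖h‖ := by fun_prop
  have := hc.tendsto 0
  rw [norm_zero, mul_zero] at this
  filter_upwards [this.eventually_lt_const hε] with h hh
  exact (seminorm_compSubConstCLM_sub_le f k n h).trans_lt hh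

/-- Translations form a group of continuous operators, so continuity at `0` spreads to every point.
-/
theorem continuous_compSubConstCLM (f : 𝓢(W, ℂ)) :
    Continuous fun w : W => compSubConstCLM ℂ w f := by
  refine continuous_iff_continuousAt.2 fun w₀ => ?_
  have h1 : Filter.Tendsto (fun w : W => compSubConstCLM ℂ (w - w₀) f) (nhds w₀) (nhds f) := by
    refine (tendsto_compSubConstCLM_zero f).comp ?_
    have : Continuous fun w : W => w - w₀ := by fun_prop
    simpa using this.tendsto w₀
  have h2 := ((compSubConstCLM ℂ w₀).continuous.tendsto f).comp h1
  refine h2.congr fun w => ?_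
  simp

end Translation

/-! ### Schwartz seminorms as norms of maps into Banach spaces, where Bochner integrals make sense.
-/

section WeightedDerivative

open BoundedContinuousFunction

/-- Bounded continuous functions on `W` with values in the `n`-linear forms on `W`. -/
def BoundedForms (W : Type) [NormedAddCommGroup W] [NormedSpace ℝ W] (n : ℕ) : Type :=
  W →ᵇ (W [×n]→L[ℝ] ℂ)

variable {W : Type} [NormedAddCommGroup W] [NormedSpace ℝ W]

instance BoundedForms.normedAddCommGroup (n : ℕ) : NormedAddCommGroup (BoundedForms W n) :=
  inferInstanceAs (NormedAddCommGroup (W →ᵇ (W [×n]→L[ℝ] ℂ)))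

instance BoundedForms.normedSpace (n : ℕ) : NormedSpace ℂ (BoundedForms W n) :=
  inferInstanceAs (NormedSpace ℂ (W →ᵇ (W [×n]→L[ℝ] ℂ)))

instance BoundedForms.completeSpace (n : ℕ) : CompleteSpace (BoundedForms W n) :=
  inferInstanceAs (CompleteSpace (W →ᵇ (W [×n]→L[ℝ] ℂ)))

/-- Evaluation at a point. -/
def BoundedForms.eval (n : ℕ) (x : W) : BoundedForms W n →L[ℂ] (W [×n]→L[ℝ] ℂ) :=
  BoundedContinuousFunction.evalCLM (β := W [×n]→L[ℝ] ℂ) ℂ x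

theorem BoundedForms.ext {n : ℕ} {F G : BoundedForms W n}
    (h : ∀ x, BoundedForms.eval n x F = BoundedForms.eval n x G) : F = G :=
  BoundedContinuousFunction.ext h

theorem BoundedForms.norm_eval_le {n : ℕ} (F : BoundedForms W n) (x : W) :
    ‖BoundedForms.eval n x F‖ ≤ ‖F‖ :=
  BoundedContinuousFunction.norm_coe_le_norm (β := W [×n]→L[ℝ] ℂ) F x

/-- The function `x ↦ ‖x‖ ^ k D^n f(x)`. -/
def weightedDerivFun (k n : ℕ) (f : 𝓢(W, ℂ)) : BoundedForms W n :=
  BoundedContinuousFunction.ofNormedAddCommGroup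
      (fun x => ‖x‖ ^ k • iteratedFDeriv ℝ n f x)
      ((continuous_norm.pow k).smul ((f.smooth n).continuous_iteratedFDeriv le_rfl))
      (SchwartzMap.seminorm ℂ k n f)
      fun x => by
        rw [norm_smul, norm_pow, norm_norm]
        exact f.le_seminorm ℂ k n x

theorem eval_weightedDerivFun (k n : ℕ) (f : 𝓢(W, ℂ)) (x : W) :
    BoundedForms.eval n x (weightedDerivFun k n f) = ‖x‖ ^ k • iteratedFDeriv ℝ n f x := rfl

theorem norm_weightedDerivFun (k n : ℕ) (f : 𝓢(W, ℂ)) :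
    ‖weightedDerivFun k n f‖ = SchwartzMap.seminorm ℂ k n f := by
  refine le_antisymm ?_ ?_
  · exact BoundedContinuousFunction.norm_ofNormedAddCommGroup_le (β := W [×n]→L[ℝ] ℂ) _
      (apply_nonneg _ _) _
  · refine seminorm_le_bound ℂ k n f (norm_nonneg _) fun x => ?_
    have := (weightedDerivFun k n f).norm_eval_le x
    rwa [eval_weightedDerivFun, norm_smul, norm_pow, norm_norm] at this

/-- The map `f ↦ (x ↦ ‖x‖ ^ k D^n f(x))` into the bounded continuous functions. -/
def weightedDeriv (W : Type) [NormedAddCommGroup W] [NormedSpace ℝ W] (k n : ℕ) :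
    𝓢(W, ℂ) →L[ℂ] BoundedForms W n :=
  mkCLMtoNormedSpace (weightedDerivFun k n)
    (fun f g => BoundedForms.ext fun x => by
      rw [map_add]
      exact (congrArg (‖x‖ ^ k • ·) (iteratedFDeriv_add_apply (f.contDiffAt n)
        (g.contDiffAt n))).trans (smul_add _ _ _))
    (fun c f => BoundedForms.ext fun x => by
      rw [map_smul]
      simp only [eval_weightedDerivFun, RingHom.id_apply]
      rw [smul_comm c]
      congr 1
      exact iteratedFDeriv_const_smul_apply (f.contDiffAt n))
    ⟨{(k, n)}, 1, zero_le_one, fun f => by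
      rw [one_mul, Finset.sup_singleton, norm_weightedDerivFun]
      rfl⟩

theorem eval_weightedDeriv (k n : ℕ) (f : 𝓢(W, ℂ)) (x : W) :
    BoundedForms.eval n x (weightedDeriv W k n f) = ‖x‖ ^ k • iteratedFDeriv ℝ n f x := rfl

theorem norm_weightedDeriv (k n : ℕ) (f : 𝓢(W, ℂ)) :
    ‖weightedDeriv W k n f‖ = SchwartzMap.seminorm ℂ k n f :=
  norm_weightedDerivFun k n f

end WeightedDerivative

/-! ### Convolution as a vector-valued integral of translates. -/

section Convolution

variable {W : Type} [NormedAddCommGroup W] [InnerProductSpace ℝ W] [FiniteDimensional ℝ W]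
  [MeasurableSpace W] [BorelSpace W]

open LineDeriv in
-- On the Fourier side convolution is a product and the derivative a multiplication, so the two
-- commute. Injectivity of the Fourier transform concludes.
theorem lineDerivOp_convS (f g : 𝓢(W, ℂ)) (m : W) : ∂_{m} (convS f g) = convS f (∂_{m} g) := by
  have hinj : Function.Injective (fun h : 𝓢(W, ℂ) => 𝓕 h) := fun a b hab => by
    have : 𝓕⁻ (𝓕 a) = 𝓕⁻ (𝓕 b) := by simp only at hab; rw [hab]
    simpa using this
  apply hinj
  ext x
  have hm : (fun x : W => inner ℝ x m).HasTemperateGrowth := by fun_prop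
  simp [convS, fourier_lineDerivOp_eq, fourier_convolution, smulLeftCLM_apply_apply hm]
  ring

open LineDeriv in
theorem iteratedLineDerivOp_convS (f g : 𝓢(W, ℂ)) (n : ℕ) (m : Fin n → W) :
    ∂^{m} (convS f g) = convS f (∂^{m} g) := by
  induction n with
  | zero => simp
  | succ n ih => rw [iteratedLineDerivOp_succ_left, iteratedLineDerivOp_succ_left, ih,
      lineDerivOp_convS]

theorem integrable_smul_iteratedFDeriv_sub (f g : 𝓢(W, ℂ)) (n : ℕ) (x : W) :
    Integrable fun y => f y • iteratedFDeriv ℝ n g (x - y) := by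
  refine (f.integrable (μ := volume)).smul_bdd (SchwartzMap.seminorm ℂ 0 n g) ?_ ?_
  · have := (g.smooth n).continuous_iteratedFDeriv le_rfl
    exact (this.comp (by fun_prop : Continuous fun y : W => x - y)).aestronglyMeasurable
  · exact .of_forall fun y => g.norm_iteratedFDeriv_le_seminorm ℂ n _

theorem iteratedFDeriv_convS (f g : 𝓢(W, ℂ)) (n : ℕ) (x : W) :
    iteratedFDeriv ℝ n (convS f g) x = ∫ y, f y • iteratedFDeriv ℝ n g (x - y) := by
  ext m
  rw [← SchwartzMap.iteratedLineDerivOp_eq_iteratedFDeriv, iteratedLineDerivOp_convS, convS_apply]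
  have h := (ContinuousMultilinearMap.apply ℝ (fun _ : Fin n => W) ℂ m).integral_comp_comm
    (integrable_smul_iteratedFDeriv_sub f g n x)
  change _ = ContinuousMultilinearMap.apply ℝ (fun _ : Fin n => W) ℂ m _
  rw [← h]
  refine integral_congr_ae (.of_forall fun y => ?_)
  simp [SchwartzMap.iteratedLineDerivOp_eq_iteratedFDeriv]

theorem convS_comm (f g : 𝓢(W, ℂ)) : convS f g = convS g f := by
  rw [convS, convS, ← SchwartzMap.convolution_flip]
  congr 3
  ext
  simp

theorem integrable_smul_weightedDeriv (f g : 𝓢(W, ℂ)) (k n : ℕ) :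
    Integrable fun w => f w • weightedDeriv W k n (compSubConstCLM ℂ w g) := by
  have hc : Continuous fun w => f w • weightedDeriv W k n (compSubConstCLM ℂ w g) :=
    f.continuous.smul ((weightedDeriv W k n).continuous.comp (continuous_compSubConstCLM g))
  have hi : Integrable fun w => 2 ^ k * (SchwartzMap.seminorm ℂ k n g * ‖f w‖ +
      SchwartzMap.seminorm ℂ 0 n g * (‖w‖ ^ k * ‖f w‖)) :=
    ((f.integrable.norm.const_mul _).add ((f.integrable_pow_mul volume k).const_mul _)).const_mul _
  refine hi.mono' hc.aestronglyMeasurable (.of_forall fun w => ?_)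
  rw [norm_smul, norm_weightedDeriv]
  have := seminorm_compSubConstCLM_le g k n w
  calc _ ≤ ‖f w‖ * (2 ^ k * (SchwartzMap.seminorm ℂ k n g +
      ‖w‖ ^ k * SchwartzMap.seminorm ℂ 0 n g)) := by gcongr
    _ = _ := by ring

/-- A rigorous form of `f * g = ∫ f(w) T_w g dw`, one seminorm at a time. Evaluation at a point is
continuous and linear, hence commutes with the Bochner integral and reduces the claim to
`iteratedFDeriv_convS`. -/
theorem weightedDeriv_convS (f g : 𝓢(W, ℂ)) (k n : ℕ) :
    weightedDeriv W k n (convS f g) =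
      ∫ w, f w • weightedDeriv W k n (compSubConstCLM ℂ w g) := by
  refine BoundedForms.ext fun x => ?_
  have h := (BoundedForms.eval n x).integral_comp_comm (integrable_smul_weightedDeriv f g k n)
  rw [← h, eval_weightedDeriv, iteratedFDeriv_convS, ← integral_smul]
  refine integral_congr_ae (.of_forall fun y => ?_)
  simp only [map_smul, eval_weightedDeriv, iteratedFDeriv_compSubConstCLM]
  rw [smul_comm]

end Convolution

/-! ### Density of the span of tensor products. -/

section Density

/-- A closed subspace of a Banach space is itself complete, so the integral may be taken inside it.
-/
theorem integral_mem_of_isClosed {α E : Type*} [MeasurableSpace α] [TopologicalSpace α]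
    [OpensMeasurableSpace α] [SecondCountableTopology α] {μ : Measure α} [NormedAddCommGroup E]
    [NormedSpace ℂ E] [CompleteSpace E] {M : Submodule ℂ E} (hM : IsClosed (M : Set E))
    {F : α → E} (hc : Continuous F) (hi : Integrable F μ) (hF : ∀ w, F w ∈ M) :
    ∫ w, F w ∂μ ∈ M := by
  have : CompleteSpace M := hM.completeSpace_coe
  have hc' : Continuous fun w => (⟨F w, hF w⟩ : M) := hc.subtype_mk _
  have hi' : Integrable (fun w => (⟨F w, hF w⟩ : M)) μ :=
    ⟨hc'.aestronglyMeasurable, hi.2⟩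
  have := M.subtypeL.integral_comp_comm hi'
  simp only [Submodule.subtypeL_apply] at this
  rw [this]
  exact Subtype.coe_prop _

variable {W : Type} [NormedAddCommGroup W] [InnerProductSpace ℝ W] [FiniteDimensional ℝ W]
  [MeasurableSpace W] [BorelSpace W]

/-- The weighted derivatives with index in a finite set. -/
def weightedDerivs (W : Type) [NormedAddCommGroup W] [NormedSpace ℝ W] (s : Finset (ℕ × ℕ)) :
    𝓢(W, ℂ) →L[ℂ] ∀ i : s, BoundedForms W i.1.2 :=
  ContinuousLinearMap.pi fun i => weightedDeriv W i.1.1 i.1.2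

theorem sup_seminorm_le_norm_weightedDerivs (s : Finset (ℕ × ℕ)) (f : 𝓢(W, ℂ)) :
    s.sup (schwartzSeminormFamily ℂ W ℂ) f ≤ ‖weightedDerivs W s f‖ := by
  refine Seminorm.finset_sup_apply_le (norm_nonneg _) fun i hi => ?_
  have := norm_le_pi_norm (weightedDerivs W s f) ⟨i, hi⟩
  rwa [weightedDerivs, ContinuousLinearMap.coe_pi', norm_weightedDeriv] at this

/-- The convolution is an integral of translates of `g`, all in `N`. A basic neighbourhood involves
finitely many seminorms, so it suffices to approximate in the Banach space that receives the
corresponding `weightedDerivs`. -/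
theorem convS_mem_topologicalClosure (N : Submodule ℂ 𝓢(W, ℂ)) (f g : 𝓢(W, ℂ))
    (hg : ∀ w, compSubConstCLM ℂ w g ∈ N) : convS f g ∈ N.topologicalClosure := by
  rw [← SetLike.mem_coe, Submodule.topologicalClosure_coe,
    mem_closure_iff_nhds_basis (schwartz_withSeminorms ℂ W ℂ).hasBasis_ball]
  rintro ⟨s, r⟩ hr
  set J := weightedDerivs W s
  set F : W → ∀ i : s, BoundedForms W i.1.2 := fun w => f w • J (compSubConstCLM ℂ w g)
  have hc : Continuous F := f.continuous.smul (J.continuous.comp (continuous_compSubConstCLM g))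
  have hi : Integrable F := Integrable.of_eval fun i =>
    integrable_smul_weightedDeriv f g i.1.1 i.1.2
  have hJ : J (convS f g) = ∫ w, F w := by
    ext1 i
    rw [eval_integral fun i => hi.eval i]
    exact weightedDeriv_convS f g i.1.1 i.1.2
  have hM : J (convS f g) ∈ (N.map J.toLinearMap).topologicalClosure := by
    rw [hJ]
    refine integral_mem_of_isClosed (Submodule.isClosed_topologicalClosure _) hc hi fun w => ?_
    exact Submodule.le_topologicalClosure _
      (Submodule.smul_mem _ _ (Submodule.mem_map_of_mem (hg w)))
  rw [← SetLike.mem_coe, Submodule.topologicalClosure_coe, Metric.mem_closure_iff] at hM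
  obtain ⟨_, ⟨h, hh, rfl⟩, hd⟩ := hM r hr
  refine ⟨h, hh, ?_⟩
  rw [Seminorm.mem_ball]
  refine (sup_seminorm_le_norm_weightedDerivs s _).trans_lt ?_
  rw [map_sub, ← dist_eq_norm, dist_comm]
  exact hd

/-- Since `ρ` has mass one, the difference is the average of `T_w f - f` against `ρ`, and only `w`
with `ρ w ≠ 0` contribute. -/
theorem seminorm_convS_sub_le {f ρ : 𝓢(W, ℂ)} {k n : ℕ} {ε : ℝ}
    (hρ : ∫ y, ρ y = 1) (hρ' : ∫ y, ‖ρ y‖ = 1)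
    (h : ∀ w, ρ w ≠ 0 → SchwartzMap.seminorm ℂ k n (compSubConstCLM ℂ w f - f) ≤ ε) :
    SchwartzMap.seminorm ℂ k n (convS ρ f - f) ≤ ε := by
  rw [← norm_weightedDeriv, map_sub, weightedDeriv_convS]
  have h1 : weightedDeriv W k n f = ∫ w, ρ w • weightedDeriv W k n f := by
    rw [integral_smul_const, hρ, one_smul]
  rw [h1, ← integral_sub (integrable_smul_weightedDeriv ρ f k n) (ρ.integrable.smul_const _)]
  calc _ ≤ ∫ w, ‖ρ w‖ * ε := by
        refine norm_integral_le_of_norm_le (ρ.integrable.norm.mul_const _) (.of_forall fun w => ?_)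
        rw [← smul_sub, norm_smul, ← map_sub, norm_weightedDeriv]
        by_cases hw : ρ w = 0
        · simp [hw]
        · gcongr
          exact h w hw
    _ = ε := by rw [integral_mul_const, hρ', one_mul]

/-- A smooth nonnegative function of integral one supported in the ball of radius `r`. -/
theorem exists_approximate_delta (V : Type) [NormedAddCommGroup V] [InnerProductSpace ℝ V]
    [FiniteDimensional ℝ V] [MeasurableSpace V] [BorelSpace V] {r : ℝ} (hr : 0 < r) :
    ∃ ρ : 𝓢(V, ℂ), ∫ y, ρ y = 1 ∧ ∫ y, ‖ρ y‖ = 1 ∧ ∀ w, ρ w ≠ 0 → ‖w‖ < r := by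
  let b : ContDiffBump (0 : V) := ⟨r / 2, r, by positivity, by linarith⟩
  have hb : HasCompactSupport fun x => (b.normed volume x : ℂ) :=
    b.hasCompactSupport_normed.comp_left Complex.ofReal_zero
  refine ⟨hb.toSchwartzMap (Complex.ofRealCLM.contDiff.comp b.contDiff_normed), ?_, ?_, ?_⟩
  · change ∫ x, (b.normed volume x : ℂ) = 1
    rw [integral_complex_ofReal, b.integral_normed, Complex.ofReal_one]
  · change ∫ x, ‖(b.normed volume x : ℂ)‖ = 1
    simp only [Complex.norm_real, Real.norm_of_nonneg (b.nonneg_normed _)]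
    exact b.integral_normed
  · intro w hw
    change (b.normed volume w : ℂ) ≠ 0 at hw
    have : w ∈ Function.support (b.normed volume) := by simpa using hw
    rw [b.support_normed_eq] at this
    simpa using this

variable {V : Type} [NormedAddCommGroup V] [InnerProductSpace ℝ V] [FiniteDimensional ℝ V]
  [MeasurableSpace V] [BorelSpace V]

theorem integral_phase {E : Type*} [NormedAddCommGroup E] [NormedSpace ℝ E] (F : Phase V → E) :
    ∫ z, F z = ∫ p : V × V, F (pt p.1 p.2) :=
  ((WithLp.volume_preserving_toLp V V).integral_comp
    (MeasurableEquiv.toLp 2 (V × V)).measurableEmbedding F).symm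

theorem compSubConstCLM_tensor (φ ψ : 𝓢(V, ℂ)) (w : Phase V) :
    compSubConstCLM ℂ w (tensor φ ψ) =
      tensor (compSubConstCLM ℂ w.fst φ) (compSubConstCLM ℂ w.snd ψ) := rfl

/-- Convolving `f` with an approximate identity of the form `ρ ⊗ ρ` approximates `f`. Each such
convolution lies in the closed span of the translates of `ρ ⊗ ρ`, and these are again tensors. -/
theorem topologicalClosure_span_tensor :
    (Submodule.span ℂ (Set.range fun p : 𝓢(V, ℂ) × 𝓢(V, ℂ) =>
      tensor p.1 p.2)).topologicalClosure = ⊤ := by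
  set N := Submodule.span ℂ (Set.range fun p : 𝓢(V, ℂ) × 𝓢(V, ℂ) => tensor p.1 p.2)
  refine eq_top_iff.2 fun f _ => ?_
  have hδ (r : ℝ) (hr : 0 < r) := exists_approximate_delta V hr
  -- For `r ≤ 0` the function `ρ r` is arbitrary. This is harmless: the limit runs over `r > 0`, and
  -- membership in the closure uses no property of `ρ r`.
  choose! ρ h1 h2 h3 using hδ
  have hlim : Filter.Tendsto (fun r : ℝ => convS f (tensor (ρ r) (ρ r)))
      (nhdsWithin 0 (Set.Ioi 0)) (nhds f) := by
    rw [(schwartz_withSeminorms ℂ (Phase V) ℂ).tendsto_nhds _ f]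
    rintro ⟨k, n⟩ ε hε
    have ht := ((schwartz_withSeminorms ℂ (Phase V) ℂ).tendsto_nhds _ f).1
      (tendsto_compSubConstCLM_zero f) (k, n) (ε / 2) (by positivity)
    rw [Metric.eventually_nhds_iff] at ht
    obtain ⟨δ, hδ, ht⟩ := ht
    -- Two components of norm below `δ / 2` give a point of Euclidean norm below `δ / √2 < δ`.
    filter_upwards [Ioo_mem_nhdsGT (by positivity : (0 : ℝ) < δ / 2)] with r hr
    refine lt_of_le_of_lt ?_ (half_lt_self hε)
    rw [convS_comm]
    refine seminorm_convS_sub_le ?_ ?_ fun w hw => ?_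
    · rw [integral_phase]
      simp only [tensor_apply]
      rw [Measure.volume_eq_prod, integral_prod_mul, h1 r hr.1, one_mul]
    · rw [integral_phase]
      simp only [tensor_apply, norm_mul]
      rw [Measure.volume_eq_prod, integral_prod_mul (fun x => ‖ρ r x‖) (fun x => ‖ρ r x‖),
        h2 r hr.1, one_mul]
    · refine (ht ?_).le
      have hw' : ρ r w.fst * ρ r w.snd ≠ 0 := hw
      have ha := h3 r hr.1 _ (left_ne_zero_of_mul hw')
      have hb := h3 r hr.1 _ (right_ne_zero_of_mul hw')
      have hr2 := hr.2
      rw [dist_zero_right, WithLp.prod_norm_eq_of_L2, Real.sqrt_lt' hδ]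
      nlinarith [norm_nonneg w.fst, norm_nonneg w.snd]
  refine N.isClosed_topologicalClosure.mem_of_tendsto hlim (.of_forall fun r => ?_)
  refine convS_mem_topologicalClosure N f _ fun w => ?_
  rw [compSubConstCLM_tensor]
  exact Submodule.subset_span ⟨(_, _), rfl⟩

end Density

/-! ### Fourier calculus in the `(2π)^{-n/2}` normalization. -/

section FourierInversion

variable {V : Type} [NormedAddCommGroup V] [InnerProductSpace ℝ V] [FiniteDimensional ℝ V]
  [MeasurableSpace V] [BorelSpace V]

theorem twoPiPow_ne_zero : twoPiPow V ≠ 0 := by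
  rw [twoPiPow]
  exact_mod_cast (by positivity : (0 : ℝ) < (2 * Real.pi) ^ ((finrank ℝ V : ℝ) / 2)).ne'

theorem conj_twoPiPow : conj (twoPiPow V) = twoPiPow V := Complex.conj_ofReal _

theorem twoPiPow_mul_self : twoPiPow V * twoPiPow V = (2 * Real.pi : ℂ) ^ finrank ℝ V := by
  rw [twoPiPow, ← Complex.ofReal_mul, ← Real.rpow_add (by positivity), add_halves,
    Real.rpow_natCast]
  push_cast
  rfl

theorem finrank_phase : finrank ℝ (Phase V) = finrank ℝ V + finrank ℝ V := by
  rw [(WithLp.linearEquiv 2 ℝ (V × V)).finrank_eq, finrank_prod]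

theorem twoPiPow_phase : twoPiPow (Phase V) = twoPiPow V * twoPiPow V := by
  rw [twoPiPow, twoPiPow, ← Complex.ofReal_mul, ← Real.rpow_add (by positivity), finrank_phase]
  congr 2
  push_cast
  ring

/-- The dictionary between this normalization and `𝓕`, whose kernel is `e^{-2πi⟨x,ξ⟩}`. -/
theorem fourierS_two_pi_smul (f : 𝓢(V, ℂ)) (ξ : V) :
    fourierS f ((2 * Real.pi) • ξ) = (twoPiPow V)⁻¹ * 𝓕 f ξ := by
  simp only [fourierS, smul_apply, ContinuousLinearMap.comp_apply,
    compCLMOfContinuousLinearEquiv_apply, Function.comp_apply, dilation_apply, smul_eq_mul,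
    fourierCLM_apply, smul_smul]
  rw [inv_mul_cancel₀ (by positivity), one_smul]

/-- Inversion for `𝓕` after the substitution `ξ ↦ 2πξ`, whose Jacobian `(2π)^n` is the square of
`twoPiPow V`. -/
theorem integral_fourierS_mul_exp (f : 𝓢(V, ℂ)) (x : V) :
    ∫ ξ, fourierS f ξ * Complex.exp (Complex.I * (⟪ξ, x⟫ : ℝ)) = twoPiPow V * f x := by
  have h := Measure.integral_comp_smul (volume : Measure V)
    (fun ξ => fourierS f ξ * Complex.exp (Complex.I * (⟪ξ, x⟫ : ℝ))) (2 * Real.pi)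
  have hf : f x = ∫ ξ, 𝓕 f ξ * Complex.exp (Complex.I * (⟪(2 * Real.pi) • ξ, x⟫ : ℝ)) := by
    conv_lhs => rw [← FourierPair.fourierInv_fourier_eq (F := 𝓢(V, ℂ)) f]
    rw [fourierInv_coe, Real.fourierInv_eq]
    refine integral_congr_ae (.of_forall fun ξ => ?_)
    simp only [Circle.smul_def, Real.fourierChar_apply, inner_smul_left, smul_eq_mul]
    rw [mul_comm]
    congr 2
    push_cast
    simp
    ring
  simp only [fourierS_two_pi_smul, mul_assoc, integral_const_mul] at h
  rw [← hf, abs_of_pos (by positivity), eq_comm, inv_smul_eq_iff₀ (by positivity)] at h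
  rw [h, Complex.real_smul]
  have h1 := twoPiPow_mul_self (V := V)
  push_cast
  rw [← h1]
  field_simp [twoPiPow_ne_zero (V := V)]

theorem integral_fourierS (f : 𝓢(V, ℂ)) : ∫ ξ, fourierS f ξ = twoPiPow V * f 0 := by
  simpa using integral_fourierS_mul_exp f 0

theorem fourierInvS_fourierS (f : 𝓢(V, ℂ)) : fourierInvS (fourierS f) = f := by
  ext x
  rw [fourierInvS_apply, integral_fourierS_mul_exp, inv_mul_cancel_left₀ twoPiPow_ne_zero]

theorem fourierInvS_eq (f : 𝓢(V, ℂ)) (x : V) : fourierInvS f x = fourierS f (-x) := by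
  simp [fourierInvS_apply, fourierS_apply]

theorem integral_fourierInvS_mul_exp (f : 𝓢(V, ℂ)) (ξ : V) :
    ∫ y, fourierInvS f y * Complex.exp (-(Complex.I * (⟪y, ξ⟫ : ℝ))) = twoPiPow V * f ξ := by
  rw [← integral_fourierS_mul_exp, ← integral_neg_eq_self]
  refine integral_congr_ae (.of_forall fun y => ?_)
  simp [fourierInvS_eq]

theorem fourierS_conjS (f : 𝓢(V, ℂ)) (ξ : V) : fourierS (conjS f) ξ = conj (fourierS f (-ξ)) := by
  simp only [fourierS_apply, map_mul, map_inv₀, conj_twoPiPow, ← integral_conj, conjS_apply]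
  congr 1
  refine integral_congr_ae (.of_forall fun y => ?_)
  simp [← Complex.exp_conj]

theorem fourierS_starS (f : 𝓢(V, ℂ)) (ξ : V) : fourierS (starS f) ξ = conj (fourierS f ξ) := by
  simp only [fourierS_apply, map_mul, map_inv₀, conj_twoPiPow, ← integral_conj, starS_apply]
  congr 1
  rw [← integral_neg_eq_self]
  refine integral_congr_ae (.of_forall fun y => ?_)
  simp [← Complex.exp_conj]

theorem fourierS_convS (f g : 𝓢(V, ℂ)) (ξ : V) :
    fourierS (convS f g) ξ = twoPiPow V * fourierS f ξ * fourierS g ξ := by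
  obtain ⟨η, rfl⟩ : ∃ η, ξ = (2 * Real.pi) • η :=
    ⟨(2 * Real.pi)⁻¹ • ξ, by rw [smul_inv_smul₀ (by positivity)]⟩
  rw [fourierS_two_pi_smul, fourierS_two_pi_smul, fourierS_two_pi_smul, convS, fourier_convolution,
    pairing_apply_apply, ContinuousLinearMap.mul_apply']
  field_simp [twoPiPow_ne_zero (V := V)]

theorem fourierS_tensor (f g : 𝓢(V, ℂ)) (ξ η : V) :
    fourierS (tensor f g) (pt ξ η) = fourierS f ξ * fourierS g η := by
  simp only [fourierS_apply, twoPiPow_phase, integral_phase, tensor_apply]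
  rw [mul_mul_mul_comm, ← integral_prod_mul, ← Measure.volume_eq_prod, mul_inv]
  congr 1
  refine integral_congr_ae (.of_forall fun y => ?_)
  simp only [WithLp.prod_inner_apply, Complex.ofReal_add, mul_add, neg_add, Complex.exp_add]
  ring

/-- The slice `y ↦ Φ(x, y)`. -/
def sliceS (Φ : 𝓢(Phase V, ℂ)) (x : V) : 𝓢(V, ℂ) :=
  PartialFourier.slice (compCLMOfContinuousLinearEquiv ℂ
    (WithLp.prodContinuousLinearEquiv 2 ℝ V V).symm Φ) x

theorem sliceS_apply (Φ : 𝓢(Phase V, ℂ)) (x y : V) : sliceS Φ x y = Φ (pt x y) := rfl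

theorem partialFourier_eq_fourierS (Φ : 𝓢(Phase V, ℂ)) (x ξ : V) :
    partialFourier Φ (pt x ξ) = fourierS (sliceS Φ x) ξ := by
  simp only [partialFourier_apply, fourierS_apply, sliceS_apply]

theorem partialFourierInv_eq_fourierInvS (Φ : 𝓢(Phase V, ℂ)) (x ξ : V) :
    partialFourierInv Φ (pt x ξ) = fourierInvS (sliceS Φ x) ξ := by
  simp only [partialFourierInv_apply, fourierInvS_apply, sliceS_apply]

theorem partialFourier_partialFourierInv (Φ : 𝓢(Phase V, ℂ)) :
    partialFourier (partialFourierInv Φ) = Φ := by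
  ext z
  obtain ⟨x, ξ, rfl⟩ : ∃ x ξ, z = pt x ξ := ⟨z.fst, z.snd, rfl⟩
  simp only [partialFourier_apply, partialFourierInv_eq_fourierInvS, integral_fourierInvS_mul_exp,
    sliceS_apply]
  rw [inv_mul_cancel_left₀ twoPiPow_ne_zero]

end FourierInversion

/-! ### The linear changes of variables preserve volume. -/

section Determinants

theorem abs_det_eq_one_of_involutive {E : Type*} [AddCommGroup E] [Module ℝ E] {f : E →ₗ[ℝ] E}
    (hf : f ∘ₗ f = LinearMap.id) : |LinearMap.det f| = 1 := by
  have h := congrArg LinearMap.det hf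
  rw [LinearMap.det_comp, LinearMap.det_id] at h
  rcases mul_self_eq_one_iff.1 h with h | h <;> simp [h]

/-- An involution has determinant `±1`. Factoring into involutions computes `|det|` in any
dimension, without choosing a basis. -/
theorem abs_det_eq_one_of_comp {E : Type*} [AddCommGroup E] [Module ℝ E] {f a b c : E →ₗ[ℝ] E}
    (ha : a ∘ₗ a = LinearMap.id) (hb : b ∘ₗ b = LinearMap.id) (hc : c ∘ₗ c = LinearMap.id)
    (hf : f = a ∘ₗ b ∘ₗ c) : |LinearMap.det f| = 1 := by
  rw [hf, LinearMap.det_comp, LinearMap.det_comp, abs_mul, abs_mul,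
    abs_det_eq_one_of_involutive ha, abs_det_eq_one_of_involutive hb,
    abs_det_eq_one_of_involutive hc]
  norm_num

variable {V : Type} [NormedAddCommGroup V] [InnerProductSpace ℝ V] [FiniteDimensional ℝ V]

theorem abs_det_kappa : |LinearMap.det (kappa V : Phase V →ₗ[ℝ] Phase V)| = 1 := by
  let F := WithLp.fstL 2 ℝ V V
  let S := WithLp.sndL 2 ℝ V V
  let mk (a b : Phase V →L[ℝ] V) : Phase V →ₗ[ℝ] Phase V :=
    ((WithLp.prodContinuousLinearEquiv 2 ℝ V V).symm.toContinuousLinearMap.comp (a.prod b))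
  -- The involutions, applied right to left, send `(x, y)` to `(x + y/2, -y)`, then to `(x + y/2,
  -- y)`, then to `(x + y/2, x - y/2)`.
  refine abs_det_eq_one_of_comp (a := mk F (F - S)) (b := mk F (-S))
    (c := mk (F + (1 / 2 : ℝ) • S) (-S)) ?_ ?_ ?_ ?_
  all_goals
    ext z
    apply WithLp.ofLp_injective 2
    ext <;> simp [mk, F, S, kappa] <;> module

theorem abs_det_symbolMap :
    |LinearMap.det (symbolMap V : Phase (Phase V) →ₗ[ℝ] Phase (Phase V))| = 1 := by
  let F := WithLp.fstL 2 ℝ (Phase V) (Phase V)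
  let S := WithLp.sndL 2 ℝ (Phase V) (Phase V)
  let F' := WithLp.fstL 2 ℝ V V
  let S' := WithLp.sndL 2 ℝ V V
  let m (a b : Phase (Phase V) →L[ℝ] V) : Phase (Phase V) →L[ℝ] Phase V :=
    ((WithLp.prodContinuousLinearEquiv 2 ℝ V V).symm.toContinuousLinearMap.comp (a.prod b))
  let mk (a b c d : Phase (Phase V) →L[ℝ] V) : Phase (Phase V) →ₗ[ℝ] Phase (Phase V) :=
    ((WithLp.prodContinuousLinearEquiv 2 ℝ (Phase V) (Phase V)).symm.toContinuousLinearMap.comp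
      ((m a b).prod (m c d)))
  let x := F'.comp F
  let y := S'.comp F
  let s := F'.comp S
  let t := S'.comp S
  refine abs_det_eq_one_of_comp (a := mk x y (y - s) t) (b := mk x y (-s) t)
    (c := mk x (y + (1 / 2 : ℝ) • s) (-s) t) ?_ ?_ ?_ ?_
  all_goals
    ext z
    apply WithLp.ofLp_injective 2
    refine Prod.ext ?_ ?_ <;> apply WithLp.ofLp_injective 2 <;> ext <;>
      simp [mk, m, F, S, F', S', x, y, s, t, symbolMap] <;> module

theorem measurePreserving_of_abs_det [MeasurableSpace V] [BorelSpace V] (A : V ≃L[ℝ] V)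
    (hA : |LinearMap.det (A : V →ₗ[ℝ] V)| = 1) : MeasurePreserving A := by
  refine ⟨A.continuous.measurable, ?_⟩
  have h := Measure.map_linearMap_addHaar_eq_smul_addHaar (volume : Measure V)
    (f := (A : V →ₗ[ℝ] V)) (fun h => by simp [h] at hA)
  rw [abs_inv, hA, inv_one, ENNReal.ofReal_one, one_smul] at h
  exact h

end Determinants

/-! ### Fourier transform of the Wigner pullback, and marginals of the cross-Wigner distribution. -/

section PhaseSpace

variable {V : Type} [NormedAddCommGroup V] [InnerProductSpace ℝ V] [FiniteDimensional ℝ V]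
  [MeasurableSpace V] [BorelSpace V]

theorem kappa_apply (x y : V) :
    kappa V (pt x y) = pt (x + (1 / 2 : ℝ) • y) (x - (1 / 2 : ℝ) • y) := rfl

/-- The transpose of `κ` sends `(ξ, -η)` to `(ξ - η, (ξ + η)/2)`. This is the origin of the
difference and midpoint coordinates in the symbol. -/
theorem inner_kappa (s t ξ η : V) : ⟪kappa V (pt s t), pt ξ (-η)⟫ =
    ⟪(pt s t : Phase V), pt (ξ - η) ((1 / 2 : ℝ) • (ξ + η))⟫ := by
  rw [kappa_apply, WithLp.prod_inner_apply, WithLp.prod_inner_apply]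
  simp only [inner_add_left, inner_sub_left, real_inner_smul_left, real_inner_smul_right,
    inner_add_right, inner_sub_right, inner_neg_right]
  ring

theorem integral_comp_kappa (F : Phase V → ℂ) : ∫ z, F (kappa V z) = ∫ z, F z :=
  (measurePreserving_of_abs_det (kappa V) abs_det_kappa).integral_comp
    (kappa V).toHomeomorph.measurableEmbedding F

theorem integrable_mul_exp (Φ : 𝓢(Phase V, ℂ)) (w : Phase V) :
    Integrable fun p : V × V => Φ (pt p.1 p.2) * Complex.exp (-(Complex.I * (⟪pt p.1 p.2, w⟫ : ℝ))) := by
  have h : Integrable fun z : Phase V => Φ z * Complex.exp (-(Complex.I * (⟪z, w⟫ : ℝ))) := by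
    refine (Φ.integrable (μ := volume)).mul_bdd (c := 1) ?_ (.of_forall fun z => ?_)
    · exact Continuous.aestronglyMeasurable (by fun_prop)
    · rw [Complex.norm_exp]
      simp
  exact ((WithLp.volume_preserving_toLp V V).integrable_comp_emb
    (MeasurableEquiv.toLp 2 (V × V)).measurableEmbedding).2 h

/-- The Fourier transform of `(𝓕₂⁻¹ Φ) ∘ κ⁻¹`. -/
theorem fourierS_partialFourierInv_kappa (Φ : 𝓢(Phase V, ℂ)) (ξ η : V) :
    fourierS (compCLMOfContinuousLinearEquiv ℂ (kappa V).symm (partialFourierInv Φ))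
      (pt ξ (-η)) = (twoPiPow V)⁻¹ * ∫ x, Φ (pt x ((1 / 2 : ℝ) • (ξ + η))) *
        Complex.exp (-(Complex.I * (⟪x, ξ - η⟫ : ℝ))) := by
  rw [fourierS_apply, ← integral_comp_kappa, integral_phase]
  set w : Phase V := pt (ξ - η) ((1 / 2 : ℝ) • (ξ + η))
  have h1 (p : V × V) : compCLMOfContinuousLinearEquiv ℂ (kappa V).symm (partialFourierInv Φ)
      (kappa V (pt p.1 p.2)) *
        Complex.exp (-(Complex.I * (⟪kappa V (pt p.1 p.2), pt ξ (-η)⟫ : ℝ))) =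
      partialFourierInv Φ (pt p.1 p.2) *
        Complex.exp (-(Complex.I * (⟪(pt p.1 p.2 : Phase V), w⟫ : ℝ))) := by
    rw [inner_kappa]
    simp [w]
  simp only [h1]
  rw [Measure.volume_eq_prod, integral_prod _ (integrable_mul_exp _ w)]
  have h2 (x : V) : ∫ y, partialFourierInv Φ (pt x y) *
      Complex.exp (-(Complex.I * (⟪(pt x y : Phase V), w⟫ : ℝ))) =
      twoPiPow V * (Φ (pt x ((1 / 2 : ℝ) • (ξ + η))) *
        Complex.exp (-(Complex.I * (⟪x, ξ - η⟫ : ℝ)))) := by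
    have h3 (y : V) : partialFourierInv Φ (pt x y) *
        Complex.exp (-(Complex.I * (⟪(pt x y : Phase V), w⟫ : ℝ))) =
        Complex.exp (-(Complex.I * (⟪x, ξ - η⟫ : ℝ))) * (fourierInvS (sliceS Φ x) y *
          Complex.exp (-(Complex.I * (⟪y, (1 / 2 : ℝ) • (ξ + η)⟫ : ℝ)))) := by
      simp only [WithLp.prod_inner_apply, Complex.ofReal_add, mul_add, neg_add, Complex.exp_add,
        partialFourierInv_eq_fourierInvS, w]
      ring
    simp only [h3]
    rw [integral_const_mul, integral_fourierInvS_mul_exp, sliceS_apply]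
    ring
  simp only [h2]
  rw [integral_const_mul, twoPiPow_phase]
  field_simp [twoPiPow_ne_zero (V := V)]

/-- Fourier inversion at the origin of the slice `y ↦ g(x + y/2) conj f(x - y/2)`. -/
theorem integral_crossWigner_snd (g f : 𝓢(V, ℂ)) (x : V) :
    ∫ ξ, crossWigner g f (pt x ξ) = twoPiPow V * (g x * conj (f x)) := by
  simp only [crossWigner, partialFourier_eq_fourierS]
  rw [integral_fourierS, sliceS_apply]
  simp [kappa_apply, tensor_apply, conjS_apply]

/-- By `inner_kappa` with `η = ξ`, the double integral is, after undoing the volume-preserving `κ`,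
the Fourier integral of `g ⊗ conj f` at `(ξ, -ξ)`, which factors. -/
theorem integral_crossWigner_fst (g f : 𝓢(V, ℂ)) (ξ : V) :
    ∫ x, crossWigner g f (pt x ξ) = twoPiPow V * (fourierS g ξ * conj (fourierS f ξ)) := by
  simp only [crossWigner, partialFourier_apply]
  have hi := integrable_mul_exp (compCLMOfContinuousLinearEquiv ℂ (kappa V)
    (tensor g (conjS f))) (pt 0 ξ)
  simp only [WithLp.prod_inner_apply, inner_zero_right, zero_add] at hi
  rw [integral_const_mul]
  have h := integral_prod _ hi
  simp only at h
  rw [← h]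
  have h2 (p : V × V) : compCLMOfContinuousLinearEquiv ℂ (kappa V) (tensor g (conjS f))
      (pt p.1 p.2) * Complex.exp (-(Complex.I * (⟪p.2, ξ⟫ : ℝ))) =
      tensor g (conjS f) (kappa V (pt p.1 p.2)) *
        Complex.exp (-(Complex.I * (⟪kappa V (pt p.1 p.2), pt ξ (-ξ)⟫ : ℝ))) := by
    rw [inner_kappa, WithLp.prod_inner_apply, sub_self, inner_zero_right, zero_add, ← two_smul ℝ ξ,
      smul_smul]
    norm_num
  simp only [h2]
  have h3 := integral_phase (V := V) fun z => tensor g (conjS f) (kappa V z) *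
        Complex.exp (-(Complex.I * (⟪kappa V z, pt ξ (-ξ)⟫ : ℝ)))
  rw [← Measure.volume_eq_prod, ← h3, integral_comp_kappa fun z => tensor g (conjS f) z *
        Complex.exp (-(Complex.I * (⟪z, pt ξ (-ξ)⟫ : ℝ)))]
  have h4 := fourierS_tensor g (conjS f) ξ (-ξ)
  rw [fourierS_apply, fourierS_conjS, neg_neg, inv_mul_eq_iff_eq_mul₀ twoPiPow_ne_zero,
    twoPiPow_phase] at h4
  rw [h4]
  field_simp [twoPiPow_ne_zero (V := V)]

theorem crossWigner_tensor (g₁ g₂ f₁ f₂ : 𝓢(V, ℂ)) (x₁ x₂ ξ₁ ξ₂ : V) :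
    crossWigner (tensor g₁ g₂) (tensor f₁ f₂) (pt (pt x₁ x₂) (pt ξ₁ ξ₂)) =
      crossWigner g₁ f₁ (pt x₁ ξ₁) * crossWigner g₂ f₂ (pt x₂ ξ₂) := by
  simp only [crossWigner_apply, twoPiPow_phase, integral_phase]
  rw [mul_mul_mul_comm, ← integral_prod_mul, ← Measure.volume_eq_prod, mul_inv]
  congr 1
  refine integral_congr_ae (.of_forall fun y => ?_)
  have h1 : (pt x₁ x₂ + (1 / 2 : ℝ) • pt y.1 y.2 : Phase V) =
    pt (x₁ + (1 / 2 : ℝ) • y.1) (x₂ + (1 / 2 : ℝ) • y.2) := rfl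
  have h2 : (pt x₁ x₂ - (1 / 2 : ℝ) • pt y.1 y.2 : Phase V) =
    pt (x₁ - (1 / 2 : ℝ) • y.1) (x₂ - (1 / 2 : ℝ) • y.2) := rfl
  simp only [h1, h2, tensor_apply, WithLp.prod_inner_apply, Complex.ofReal_add, mul_add, neg_add,
    Complex.exp_add, map_mul]
  ring

end PhaseSpace

/-! ### Separate continuity of tensors, and extension from tensors by density. -/

section TensorContinuity

variable {V : Type} [NormedAddCommGroup V] [InnerProductSpace ℝ V] [FiniteDimensional ℝ V]
  [MeasurableSpace V] [BorelSpace V]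

/-- Leibniz rule with a bound that is a product of a seminorm of `φ` and one of `ψ`; this explicit
form gives continuity in either factor. -/
theorem norm_pow_mul_iteratedFDeriv_tensor_le (φ ψ : 𝓢(V, ℂ)) (k n : ℕ) (z : Phase V) :
    ‖z‖ ^ k * ‖iteratedFDeriv ℝ n (tensor φ ψ) z‖ ≤
      ∑ i ∈ Finset.range (n + 1), (n.choose i : ℝ) *
        (2 ^ k * ((Finset.Iic (k, n)).sup (schwartzSeminormFamily ℂ V ℂ)) φ) *
        (2 ^ k * ((Finset.Iic (k, n)).sup (schwartzSeminormFamily ℂ V ℂ)) ψ) := by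
  have hB (f : 𝓢(V, ℂ)) (i : ℕ) (hi : i ≤ n) (x : V) :
      (1 + ‖x‖) ^ k * ‖iteratedFDeriv ℝ i f x‖ ≤
        2 ^ k * ((Finset.Iic (k, n)).sup (schwartzSeminormFamily ℂ V ℂ)) f :=
    one_add_le_sup_seminorm_apply (𝕜 := ℂ) (m := (k, n)) le_rfl hi f x
  have hf1 : ‖WithLp.fstL 2 ℝ V V‖ ≤ 1 :=
    ContinuousLinearMap.opNorm_le_bound _ zero_le_one fun z => by
      simpa using WithLp.norm_fst_le _ z
  have hs1 : ‖WithLp.sndL 2 ℝ V V‖ ≤ 1 :=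
    ContinuousLinearMap.opNorm_le_bound _ zero_le_one fun z => by
      simpa using WithLp.norm_snd_le _ z
  have h1 := norm_iteratedFDeriv_mul_le (𝕜 := ℝ) (N := n)
    (f := fun z : Phase V => φ (WithLp.fstL 2 ℝ V V z))
    (g := fun z : Phase V => ψ (WithLp.sndL 2 ℝ V V z))
    ((φ.smooth n).comp (WithLp.fstL 2 ℝ V V).contDiff)
    ((ψ.smooth n).comp (WithLp.sndL 2 ℝ V V).contDiff) z (n := n) le_rfl
  have hz : ‖z‖ ^ k ≤ (1 + ‖z.fst‖) ^ k * (1 + ‖z.snd‖) ^ k := by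
    rw [← mul_pow]
    gcongr
    linarith [one_add_norm_le z]
  refine (mul_le_mul hz h1 (norm_nonneg _) (by positivity)).trans ?_
  rw [Finset.mul_sum]
  refine Finset.sum_le_sum fun i hi => ?_
  have hin : i ≤ n := by
    rw [Finset.mem_range] at hi
    omega
  have ha := norm_iteratedFDeriv_comp_le_of_le_one φ _ hf1 i z
  have hb := norm_iteratedFDeriv_comp_le_of_le_one ψ _ hs1 (n - i) z
  have hc := hB φ i hin z.fst
  have hd := hB ψ (n - i) (Nat.sub_le _ _) z.snd
  calc _ ≤ (1 + ‖z.fst‖) ^ k * (1 + ‖z.snd‖) ^ k * ((n.choose i : ℝ) *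
        ‖iteratedFDeriv ℝ i φ z.fst‖ * ‖iteratedFDeriv ℝ (n - i) ψ z.snd‖) := by
        gcongr
        · exact ha
        · exact hb
    _ = (n.choose i : ℝ) * ((1 + ‖z.fst‖) ^ k * ‖iteratedFDeriv ℝ i φ z.fst‖) *
        ((1 + ‖z.snd‖) ^ k * ‖iteratedFDeriv ℝ (n - i) ψ z.snd‖) := by ring
    _ ≤ _ := by gcongr

/-- `φ ↦ φ ⊗ ψ` as a continuous linear map. -/
def tensorLeft (ψ : 𝓢(V, ℂ)) : 𝓢(V, ℂ) →L[ℂ] 𝓢(Phase V, ℂ) :=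
  mkCLM (fun φ => tensor φ ψ) (fun φ φ' z => add_mul (φ z.fst) (φ' z.fst) _)
    (fun c φ z => mul_assoc c (φ z.fst) (ψ z.snd)) (fun φ => (tensor φ ψ).smooth') fun n =>
    ⟨Finset.Iic n, ∑ i ∈ Finset.range (n.2 + 1), (n.2.choose i : ℝ) * 2 ^ n.1 *
        (2 ^ n.1 * ((Finset.Iic n).sup (schwartzSeminormFamily ℂ V ℂ)) ψ), by positivity,
      fun φ z => (norm_pow_mul_iteratedFDeriv_tensor_le φ ψ n.1 n.2 z).trans_eq (by
        rw [Finset.sum_mul]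
        refine Finset.sum_congr rfl fun i _ => ?_
        ring)⟩

/-- `ψ ↦ φ ⊗ ψ` as a continuous linear map. -/
def tensorRight (φ : 𝓢(V, ℂ)) : 𝓢(V, ℂ) →L[ℂ] 𝓢(Phase V, ℂ) :=
  mkCLM (fun ψ => tensor φ ψ) (fun ψ ψ' z => mul_add (φ z.fst) (ψ z.snd) (ψ' z.snd))
    (fun c ψ z => mul_left_comm (φ z.fst) c (ψ z.snd)) (fun ψ => (tensor φ ψ).smooth') fun n =>
    ⟨Finset.Iic n, ∑ i ∈ Finset.range (n.2 + 1), (n.2.choose i : ℝ) * 2 ^ n.1 *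
        (2 ^ n.1 * ((Finset.Iic n).sup (schwartzSeminormFamily ℂ V ℂ)) φ), by positivity,
      fun ψ z => (norm_pow_mul_iteratedFDeriv_tensor_le φ ψ n.1 n.2 z).trans_eq (by
        rw [Finset.sum_mul]
        refine Finset.sum_congr rfl fun i _ => ?_
        ring)⟩

theorem conjS_conjS (f : 𝓢(V, ℂ)) : conjS (conjS f) = f := by
  ext x
  simp [conjS_apply]

variable (V) in
/-- Complex conjugation as a continuous conjugate linear map. -/
def conjL : 𝓢(V, ℂ) →L⋆[ℂ] 𝓢(V, ℂ) where
  toFun := conjS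
  map_add' f g := map_add _ f g
  map_smul' c f := by
    ext x
    exact map_mul (starRingEnd ℂ) _ _
  cont := (postcompCLM (𝕜 := ℝ) (Complex.conjCLE : ℂ →L[ℝ] ℂ)).continuous

/-- Continuous semilinear maps that agree on the functions `φ ⊗ conj ψ` are equal. -/
theorem ext_of_tensor {τ : ℂ →+* ℂ} {E : Type*} [AddCommMonoid E] [TopologicalSpace E]
    [T2Space E] [Module ℂ E] {S T : 𝓢(Phase V, ℂ) →SL[τ] E}
    (h : ∀ φ ψ : 𝓢(V, ℂ), S (tensor φ (conjS ψ)) = T (tensor φ (conjS ψ))) : S = T := by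
  refine ContinuousLinearMap.ext_on (s := Set.range fun p : 𝓢(V, ℂ) × 𝓢(V, ℂ) =>
    tensor p.1 p.2) ?_ ?_
  · rw [Submodule.dense_iff_topologicalClosure_eq_top]
    exact topologicalClosure_span_tensor
  · rintro _ ⟨⟨φ, ψ⟩, rfl⟩
    have := h φ (conjS ψ)
    rwa [conjS_conjS] at this

/-- A tempered distribution is determined by its values on the cross-Wigner distributions. -/
theorem ext_of_crossWigner {S T : TD (Phase V)}
    (h : ∀ g f : 𝓢(V, ℂ), S (crossWigner g f) = T (crossWigner g f)) : S = T := by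
  -- `A` sends `g ⊗ conj f` to `W(g, f)` and has the right inverse `Φ ↦ (𝓕₂⁻¹ Φ) ∘ κ⁻¹`. Agreement
  -- on tensors therefore reaches every `Φ`.
  let A : 𝓢(Phase V, ℂ) →L[ℂ] 𝓢(Phase V, ℂ) :=
    partialFourier.comp (compCLMOfContinuousLinearEquiv ℂ (kappa V))
  have hA : S.comp A = T.comp A := ext_of_tensor fun g f => h g f
  ext Φ
  have hΦ : A (compCLMOfContinuousLinearEquiv ℂ (kappa V).symm (partialFourierInv Φ)) = Φ := by
    simp only [A, ContinuousLinearMap.comp_apply]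
    have : compCLMOfContinuousLinearEquiv ℂ (kappa V) (compCLMOfContinuousLinearEquiv ℂ
        (kappa V).symm (partialFourierInv Φ)) = partialFourierInv Φ := by
      ext z
      simp
    rw [this, partialFourier_partialFourierInv]
  rw [← hΦ]
  exact DFunLike.congr_fun hA _

/-- `g ↦ W(g, f)` as a continuous linear map. -/
def crossWignerLeft (f : 𝓢(V, ℂ)) : 𝓢(V, ℂ) →L[ℂ] 𝓢(Phase V, ℂ) :=
  (partialFourier.comp (compCLMOfContinuousLinearEquiv ℂ (kappa V))).comp (tensorLeft (conjS f))

/-- `f ↦ W(g, f)` as a continuous conjugate linear map. -/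
def crossWignerRight (g : 𝓢(V, ℂ)) : 𝓢(V, ℂ) →L⋆[ℂ] 𝓢(Phase V, ℂ) :=
  ((partialFourier.comp (compCLMOfContinuousLinearEquiv ℂ (kappa V))).comp (tensorRight g)).comp
    (conjL V)

end TensorContinuity

/-! ### Exchange of the middle factors of a fourfold product measure. -/

section Rearrangement

variable {α β γ δ : Type*} [MeasurableSpace α] [MeasurableSpace β] [MeasurableSpace γ]
  [MeasurableSpace δ]

theorem measurePreserving_prodProdProdComm (a : Measure α) (b : Measure β) (c : Measure γ)
    (d : Measure δ) [SFinite a] [SFinite b] [SFinite c] [SFinite d] :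
    MeasurePreserving (fun p : (α × β) × (γ × δ) => ((p.1.1, p.2.1), (p.1.2, p.2.2)))
      ((a.prod b).prod (c.prod d)) ((a.prod c).prod (b.prod d)) := by
  have h1 := measurePreserving_prodAssoc a b (c.prod d)
  have h2 := (MeasurePreserving.id a).prod ((measurePreserving_prodAssoc b c d).symm _)
  have h3 := (MeasurePreserving.id a).prod
    ((Measure.measurePreserving_swap (μ := b) (ν := c)).prod (MeasurePreserving.id d))
  have h4 := (MeasurePreserving.id a).prod (measurePreserving_prodAssoc c b d)
  have h5 := (measurePreserving_prodAssoc a c (b.prod d)).symm _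
  exact h5.comp (h4.comp (h3.comp (h2.comp h1)))

end Rearrangement

/-! ### The candidate symbol as an inner product in `L²(μ ⊗ μ)`. -/

section Symbol

variable {V : Type} [NormedAddCommGroup V] [InnerProductSpace ℝ V] [FiniteDimensional ℝ V]
  [MeasurableSpace V] [BorelSpace V]

theorem measurePreserving_pt (μ ν : Measure V) :
    MeasurePreserving (fun p : V × V => (pt p.1 p.2 : Phase V)) (μ.prod ν) (prodMeasure μ ν) :=
  ⟨(MeasurableEquiv.toLp 2 (V × V)).measurable, rfl⟩

theorem integral_prodMeasure (μ ν : Measure V) (F : Phase V → ℂ) :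
    ∫ z, F z ∂prodMeasure μ ν = ∫ p, F (pt p.1 p.2) ∂μ.prod ν :=
  ((measurePreserving_pt μ ν).integral_comp
    (MeasurableEquiv.toLp 2 (V × V)).measurableEmbedding F).symm

/-- Integration against `1 ⊗ μ ⊗ μ ⊗ 1`. -/
theorem integral_one_prod_prod_one (μ : Measure V) [μ.HasTemperateGrowth]
    (Ψ : 𝓢(Phase (Phase V), ℂ)) :
    ∫ z, Ψ z ∂prodMeasure (prodMeasure volume μ) (prodMeasure μ volume) =
      ∫ p, (∫ q : V × V, Ψ (pt (pt q.1 p.1) (pt p.2 q.2))) ∂μ.prod μ := by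
  have := sigmaFinite_of_hasTemperateGrowth μ
  have := sigmaFinite_of_hasTemperateGrowth (prodMeasure (volume : Measure V) μ)
  have := sigmaFinite_of_hasTemperateGrowth (prodMeasure μ (volume : Measure V))
  have h1 := measurePreserving_prodProdProdComm (volume : Measure V) (volume : Measure V) μ μ
  have h2 := (MeasurePreserving.id ((volume : Measure V).prod μ)).prod
    (Measure.measurePreserving_swap (μ := (volume : Measure V)) (ν := μ))
  have h3 := (measurePreserving_pt (volume : Measure V) μ).prod (measurePreserving_pt μ volume)
  -- The composite sends `(p, q)` to `(q₁, p₁, p₂, q₂)`. With the two `μ`-variables outermost,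
  -- Fubini leaves the Lebesgue integral inside.
  have h := ((measurePreserving_pt (prodMeasure volume μ) (prodMeasure μ volume)).comp
    (h3.comp (h2.comp h1))).comp (Measure.measurePreserving_swap (μ := μ.prod μ)
      (ν := (volume : Measure V).prod volume))
  rw [← h.map_eq, integral_map h.measurable.aemeasurable Ψ.continuous.aestronglyMeasurable,
    integral_prod]
  · rfl
  · exact h.integrable_comp_of_integrable
      (Ψ.integrable (μ := prodMeasure (prodMeasure volume μ) (prodMeasure μ volume)))

/-- The distribution `(1 ⊗ μ ⊗ μ ⊗ 1) ∘ A`. -/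
def symbolTD (μ : Measure V) [μ.HasTemperateGrowth] : TD (Phase (Phase V)) :=
  TD.compLinear (TD.ofMeasure (prodMeasure (prodMeasure volume μ) (prodMeasure μ volume)))
    (symbolMap V)

theorem symbolTD_apply (μ : Measure V) [μ.HasTemperateGrowth] (Ψ : 𝓢(Phase (Phase V), ℂ)) :
    symbolTD μ Ψ = conj (∫ p, (∫ q : V × V, Ψ (pt (pt q.1 ((1 / 2 : ℝ) • (p.1 + p.2)))
      (pt (p.1 - p.2) q.2))) ∂μ.prod μ) := by
  rw [symbolTD, TD.compLinear, abs_det_symbolMap, inv_one, Complex.ofReal_one, one_smul,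
    ContinuousLinearMap.comp_apply, TD.ofMeasure_apply, integral_conj, integral_one_prod_prod_one]
  rfl

variable (V) in
/-- The reflection `(x, y) ↦ (x, -y)`. -/
def reflectSnd : Phase V ≃L[ℝ] Phase V :=
  ((WithLp.prodContinuousLinearEquiv 2 ℝ V V).trans ((ContinuousLinearEquiv.refl ℝ V).prodCongr
    (ContinuousLinearEquiv.neg ℝ))).trans (WithLp.prodContinuousLinearEquiv 2 ℝ V V).symm

/-- `F ↦ ((ξ, η) ↦ F^(ξ, -η))`. -/
def reflectedFourier : 𝓢(Phase V, ℂ) →L[ℂ] 𝓢(Phase V, ℂ) :=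
  (compCLMOfContinuousLinearEquiv ℂ (reflectSnd V)).comp fourierS

theorem reflectedFourier_apply (F : 𝓢(Phase V, ℂ)) (ξ η : V) :
    reflectedFourier F (pt ξ η) = fourierS F (pt ξ (-η)) := rfl

theorem reflectedFourier_tensor (φ ψ : 𝓢(V, ℂ)) (ξ η : V) :
    reflectedFourier (tensor φ (conjS ψ)) (pt ξ η) = fourierS φ ξ * conj (fourierS ψ η) := by
  rw [reflectedFourier_apply, fourierS_tensor, fourierS_conjS, neg_neg]

/-- `F ↦ ((ξ, η) ↦ F^(ξ, -η))` as a map into `L²(μ ⊗ μ)`. -/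
def spectralMap (μ : Measure V) [μ.HasTemperateGrowth] :
    𝓢(Phase V, ℂ) →L[ℂ] Lp ℂ 2 (prodMeasure μ μ) :=
  (toLpCLM ℂ ℂ 2 (prodMeasure μ μ)).comp reflectedFourier

theorem inner_spectralMap (μ : Measure V) [μ.HasTemperateGrowth] (F G : 𝓢(Phase V, ℂ)) :
    inner ℂ (spectralMap μ F) (spectralMap μ G) =
      ∫ p, conj (reflectedFourier F (pt p.1 p.2)) * reflectedFourier G (pt p.1 p.2) ∂μ.prod μ := by
  rw [← integral_prodMeasure μ μ fun z => conj (reflectedFourier F z) * reflectedFourier G z]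
  refine (inner_toL2_toL2_eq (reflectedFourier F) (reflectedFourier G) (prodMeasure μ μ)).trans ?_
  refine integral_congr_ae (.of_forall fun z => ?_)
  simp [mul_comm]

theorem inner_spectralMap_tensor (μ : Measure V) [μ.HasTemperateGrowth] (φ ψ φ' ψ' : 𝓢(V, ℂ)) :
    inner ℂ (spectralMap μ (tensor φ (conjS ψ))) (spectralMap μ (tensor φ' (conjS ψ'))) =
      (∫ ξ, conj (fourierS φ ξ) * fourierS φ' ξ ∂μ) *
        ∫ η, conj (fourierS ψ' η) * fourierS ψ η ∂μ := by
  have := sigmaFinite_of_hasTemperateGrowth μ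
  rw [inner_spectralMap, ← integral_prod_mul]
  refine integral_congr_ae (.of_forall fun p => ?_)
  simp only [reflectedFourier_tensor, map_mul, Complex.conj_conj]
  ring

variable (V) in
/-- `Φ ↦ (𝓕₂⁻¹ Φ) ∘ κ⁻¹`. -/
def wignerPullback : 𝓢(Phase V, ℂ) →L[ℂ] 𝓢(Phase V, ℂ) :=
  (compCLMOfContinuousLinearEquiv ℂ (kappa V).symm).comp partialFourierInv

theorem reflectedFourier_wignerPullback (Φ : 𝓢(Phase V, ℂ)) (ξ η : V) :
    reflectedFourier (wignerPullback V Φ) (pt ξ η) =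
      (twoPiPow V)⁻¹ * ∫ x, Φ (pt x ((1 / 2 : ℝ) • (ξ + η))) *
        Complex.exp (-(Complex.I * (⟪x, ξ - η⟫ : ℝ))) :=
  fourierS_partialFourierInv_kappa Φ ξ η

theorem reflectedFourier_wignerPullback_tensor (f₁ f₂ : 𝓢(V, ℂ)) (ξ η : V) :
    reflectedFourier (wignerPullback V (tensor f₁ f₂)) (pt ξ η) =
      fourierS f₁ (ξ - η) * f₂ ((1 / 2 : ℝ) • (ξ + η)) := by
  rw [reflectedFourier_wignerPullback, fourierS_apply, mul_assoc, ← integral_mul_const]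
  congr 1
  refine integral_congr_ae (.of_forall fun x => ?_)
  simp only [tensor_apply]
  ring

/-- For tensors, `W` factors into a distribution in `(x₁, ξ₁)` and one in `(x₂, ξ₂)`. The integral
over `x₁` produces `ĝ₁ conj f̂₁` at `ξ - η`, and the integral over `ξ₂` produces `g₂ conj f₂` at `(ξ
+ η)/2`. Up to conjugation these are the factors of the `L²` integrand, and the two marginal
constants multiply to `twoPiPow (Phase V)`. -/
theorem symbolTD_crossWigner_tensor (μ : Measure V) [μ.HasTemperateGrowth]
    (g₁ g₂ f₁ f₂ : 𝓢(V, ℂ)) :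
    symbolTD μ (crossWigner (tensor g₁ g₂) (tensor f₁ f₂)) =
      twoPiPow (Phase V) * inner ℂ (spectralMap μ (wignerPullback V (tensor g₁ g₂)))
        (spectralMap μ (wignerPullback V (tensor f₁ f₂))) := by
  rw [symbolTD_apply, inner_spectralMap, ← integral_conj, ← integral_const_mul]
  refine integral_congr_ae (.of_forall fun p => ?_)
  simp only [crossWigner_tensor, reflectedFourier_wignerPullback_tensor]
  rw [Measure.volume_eq_prod, integral_prod_mul
    (fun x => crossWigner g₁ f₁ (pt x (p.1 - p.2)))
    (fun ξ => crossWigner g₂ f₂ (pt ((1 / 2 : ℝ) • (p.1 + p.2)) ξ)), integral_crossWigner_fst,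
    integral_crossWigner_snd, twoPiPow_phase]
  simp only [map_mul, Complex.conj_conj, conj_twoPiPow]
  ring

theorem symbolTD_crossWigner (μ : Measure V) [μ.HasTemperateGrowth] (g f : 𝓢(Phase V, ℂ)) :
    symbolTD μ (crossWigner g f) = twoPiPow (Phase V) *
      inner ℂ (spectralMap μ (wignerPullback V g)) (spectralMap μ (wignerPullback V f)) := by
  set J := (spectralMap μ).comp (wignerPullback V)
  -- Density is used one argument at a time: both sides are continuous and antilinear in `g`,
  -- continuous and linear in `f`.
  have h1 (f₁ f₂ : 𝓢(V, ℂ)) : (symbolTD μ).comp (crossWignerLeft (tensor f₁ f₂)) =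
      twoPiPow (Phase V) • (innerSLFlip ℂ (J (tensor f₁ f₂))).comp J :=
    ext_of_tensor fun g₁ g₂ => symbolTD_crossWigner_tensor μ g₁ (conjS g₂) f₁ f₂
  have h2 (g : 𝓢(Phase V, ℂ)) : (symbolTD μ).comp (crossWignerRight g) =
      twoPiPow (Phase V) • (innerSL ℂ (J g)).comp J :=
    ext_of_tensor fun f₁ f₂ => DFunLike.congr_fun (h1 f₁ (conjS f₂)) g
  exact DFunLike.congr_fun (h2 g) f

end Symbol

/-! ### Fourth moments of jointly Gaussian variables. -/

section Isserlis

open ProbabilityTheory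
open scoped NNReal ENNReal

variable {Ω : Type*} [MeasurableSpace Ω] {P : Measure Ω}

/-- The fourth derivative at `0` of the moment generating function `e^{vt²/2}`. -/
theorem integral_pow_four_gaussianReal (v : ℝ≥0) : ∫ x, x ^ 4 ∂gaussianReal 0 v = 3 * (v : ℝ) ^ 2 := by
  have h := iteratedDeriv_mgf_zero (X := fun x : ℝ => x) (μ := gaussianReal 0 v) (by simp) 4
  have h0 : mgf (fun x : ℝ => x) (gaussianReal 0 v) = fun t => Real.exp (v * t ^ 2 / 2) := by
    rw [mgf_fun_id_gaussianReal]
    simp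
  have he (t : ℝ) : HasDerivAt (fun t : ℝ => Real.exp (v * t ^ 2 / 2))
      (v * t * Real.exp (v * t ^ 2 / 2)) t := by
    have h1 : HasDerivAt (fun t : ℝ => v * t ^ 2 / 2) (v * t) t := by
      have := ((hasDerivAt_pow 2 t).const_mul (v : ℝ)).div_const 2
      exact this.congr_deriv (by push_cast; ring)
    exact h1.exp.congr_deriv (by ring)
  have h1 : deriv (fun t : ℝ => Real.exp (v * t ^ 2 / 2)) =
      fun t => v * t * Real.exp (v * t ^ 2 / 2) := funext fun t => (he t).deriv
  have h2 : deriv (fun t : ℝ => v * t * Real.exp (v * t ^ 2 / 2)) =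
      fun t => (v + v ^ 2 * t ^ 2) * Real.exp (v * t ^ 2 / 2) := funext fun t => by
    have := ((hasDerivAt_id' t).const_mul (v : ℝ)).fun_mul (he t)
    rw [this.deriv]
    ring
  have h3 : deriv (fun t : ℝ => (v + v ^ 2 * t ^ 2) * Real.exp (v * t ^ 2 / 2)) =
      fun t => (3 * v ^ 2 * t + v ^ 3 * t ^ 3) * Real.exp (v * t ^ 2 / 2) := funext fun t => by
    have := (((hasDerivAt_pow 2 t).const_mul ((v : ℝ) ^ 2)).const_add (v : ℝ)).fun_mul (he t)
    rw [this.deriv]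
    norm_num
    ring
  have h4 : deriv (fun t : ℝ => (3 * v ^ 2 * t + v ^ 3 * t ^ 3) * Real.exp (v * t ^ 2 / 2)) 0 =
      3 * (v : ℝ) ^ 2 := by
    have := (((hasDerivAt_id' (0 : ℝ)).const_mul (3 * (v : ℝ) ^ 2)).fun_add
      ((hasDerivAt_pow 3 (0 : ℝ)).const_mul ((v : ℝ) ^ 3))).fun_mul (he 0)
    rw [this.deriv]
    simp
  rw [iteratedDeriv_succ, iteratedDeriv_succ, iteratedDeriv_succ, iteratedDeriv_one, h0, h1, h2, h3,
    h4] at h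
  exact h.symm

theorem integral_pow_four_of_hasGaussianLaw {X : Ω → ℝ} (hX : HasGaussianLaw X P)
    (h0 : ∫ ω, X ω ∂P = 0) : ∫ ω, X ω ^ 4 ∂P = 3 * (∫ ω, X ω ^ 2 ∂P) ^ 2 := by
  have h := hX.map_eq_gaussianReal
  have hv : ((Var[X; P]).toNNReal : ℝ) = ∫ ω, X ω ^ 2 ∂P := by
    rw [Real.coe_toNNReal _ (variance_nonneg _ _), variance_of_integral_eq_zero hX.aemeasurable h0]
  rw [← hv, ← integral_pow_four_gaussianReal, ← h0, ← h, integral_map hX.aemeasurable (by fun_prop)]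

theorem memLp_four_of_isGaussianProcess {T : Type*} {X : T → Ω → ℝ} (hX : IsGaussianProcess X P)
    (t : T) : MemLp (X t) 4 P :=
  (hX.hasGaussianLaw_eval t).memLp (by norm_num)

theorem memLp_two_mul {𝕜 : Type*} [RCLike 𝕜] {A B : Ω → 𝕜} (hA : MemLp A 4 P) (hB : MemLp B 4 P) :
    MemLp (fun ω => A ω * B ω) 2 P := by
  have : ENNReal.HolderTriple 4 4 2 := ⟨by
    rw [← two_mul, show (4 : ℝ≥0∞) = 2 * 2 by norm_num, ENNReal.mul_inv (by simp) (by simp),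
      ← mul_assoc, ENNReal.mul_inv_cancel (by simp) (by simp), one_mul]⟩
  exact hB.mul (r := 2) hA

theorem integrable_mul_four {𝕜 : Type*} [RCLike 𝕜] {A B C D : Ω → 𝕜} (hA : MemLp A 4 P)
    (hB : MemLp B 4 P) (hC : MemLp C 4 P) (hD : MemLp D 4 P) :
    Integrable (fun ω => A ω * B ω * C ω * D ω) P := by
  have := (memLp_two_mul hA hB).integrable_mul (memLp_two_mul hC hD)
  refine this.congr (.of_forall fun ω => ?_)
  simp only [Pi.mul_apply]
  ring

theorem integrable_mul_two {𝕜 : Type*} [RCLike 𝕜] [IsFiniteMeasure P] {A B : Ω → 𝕜}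
    (hA : MemLp A 4 P) (hB : MemLp B 4 P) : Integrable (fun ω => A ω * B ω) P :=
  (memLp_two_mul hA hB).integrable (by norm_num)

/-- Isserlis' theorem for four real centered Gaussian variables. -/
theorem isserlis_real [IsProbabilityMeasure P] {X : Fin 4 → Ω → ℝ} (hX : IsGaussianProcess X P)
    (h0 : ∀ i, ∫ ω, X i ω ∂P = 0) :
    ∫ ω, X 0 ω * X 1 ω * X 2 ω * X 3 ω ∂P =
      (∫ ω, X 0 ω * X 1 ω ∂P) * (∫ ω, X 2 ω * X 3 ω ∂P) +
      (∫ ω, X 0 ω * X 2 ω ∂P) * (∫ ω, X 1 ω * X 3 ω ∂P) +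
      (∫ ω, X 0 ω * X 3 ω ∂P) * (∫ ω, X 1 ω * X 2 ω ∂P) := by
  have hm := memLp_four_of_isGaussianProcess hX
  let S (c : Fin 4 → ℝ) (ω : Ω) : ℝ := ∑ i, c i * X i ω
  have hS (c : Fin 4 → ℝ) : HasGaussianLaw (S c) P := by
    simpa using (hX.smul c).hasGaussianLaw_fun_sum (I := Finset.univ)
  have hS0 (c : Fin 4 → ℝ) : ∫ ω, S c ω ∂P = 0 := by
    simp only [S]
    rw [integral_finsetSum _ fun i _ => (hX.hasGaussianLaw_eval i).integrable.const_mul _]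
    simp [integral_const_mul, h0]
  have hS2 (c : Fin 4 → ℝ) : ∫ ω, S c ω ^ 2 ∂P =
      ∑ i, ∑ j, c i * c j * ∫ ω, X i ω * X j ω ∂P := by
    have h1 (ω : Ω) : S c ω ^ 2 = ∑ i, ∑ j, c i * c j * (X i ω * X j ω) := by
      simp only [S]
      rw [sq, Finset.sum_mul_sum]
      refine Finset.sum_congr rfl fun i _ => Finset.sum_congr rfl fun j _ => ?_
      ring
    simp only [h1]
    have hi (i j : Fin 4) : Integrable (fun ω => c i * c j * (X i ω * X j ω)) P :=
      (integrable_mul_two (hm i) (hm j)).const_mul _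
    rw [integral_finsetSum _ fun i _ => integrable_finsetSum _ fun j _ => hi i j]
    refine Finset.sum_congr rfl fun i _ => ?_
    rw [integral_finsetSum _ fun j _ => hi i j]
    simp only [integral_const_mul]
  have hS4 (c : Fin 4 → ℝ) : Integrable (fun ω => S c ω ^ 4) P := by
    have h := (hS c).memLp (p := 4) (by norm_num)
    refine (integrable_mul_four h h h h).congr (.of_forall fun ω => ?_)
    simp only
    ring
  have hE (c : Fin 4 → ℝ) : ∫ ω, S c ω ^ 4 ∂P =
      3 * (∑ i, ∑ j, c i * c j * ∫ ω, X i ω * X j ω ∂P) ^ 2 := by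
    rw [integral_pow_four_of_hasGaussianLaw (hS c) (hS0 c), hS2]
  -- Polarization: the signed sum over the eight sign patterns retains only the monomial `X₀X₁X₂X₃`,
  -- with coefficient `8 · 4! = 192`. Each `S c` is a centered Gaussian variable, so its fourth
  -- moment is three times its squared variance.
  have hpol (ω : Ω) : X 0 ω * X 1 ω * X 2 ω * X 3 ω = (1 / 192) *
      (S ![1, 1, 1, 1] ω ^ 4 - S ![1, 1, 1, -1] ω ^ 4 - S ![1, 1, -1, 1] ω ^ 4
        + S ![1, 1, -1, -1] ω ^ 4 - S ![1, -1, 1, 1] ω ^ 4 + S ![1, -1, 1, -1] ω ^ 4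
        + S ![1, -1, -1, 1] ω ^ 4 - S ![1, -1, -1, -1] ω ^ 4) := by
    simp only [S, Fin.sum_univ_four, Matrix.cons_val]
    ring
  simp only [hpol]
  rw [integral_const_mul, integral_sub (by fun_prop) (hS4 _), integral_add (by fun_prop) (hS4 _),
    integral_add (by fun_prop) (hS4 _), integral_sub (by fun_prop) (hS4 _),
    integral_add (by fun_prop) (hS4 _), integral_sub (by fun_prop) (hS4 _),
    integral_sub (hS4 _) (hS4 _)]
  simp only [hE, Fin.sum_univ_four, Matrix.cons_val]
  have hc (i j : Fin 4) : ∫ ω, X i ω * X j ω ∂P = ∫ ω, X j ω * X i ω ∂P := by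
    simp only [mul_comm]
  rw [hc 1 0, hc 2 0, hc 3 0, hc 2 1, hc 3 1, hc 3 2]
  ring

/-- The Wick formula for the expectation of a product of four complex random variables. -/
def WickFormula (P : Measure Ω) (A B C D : Ω → ℂ) : Prop :=
  ∫ ω, A ω * B ω * C ω * D ω ∂P =
    (∫ ω, A ω * B ω ∂P) * (∫ ω, C ω * D ω ∂P) + (∫ ω, A ω * C ω ∂P) * (∫ ω, B ω * D ω ∂P) +
      (∫ ω, A ω * D ω ∂P) * (∫ ω, B ω * C ω ∂P)

/-- Cyclic invariance, so that linearity has to be checked in the first slot only. -/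
theorem WickFormula.rotate {A B C D : Ω → ℂ} (h : WickFormula P A B C D) :
    WickFormula P B C D A := by
  have h1 : ∫ ω, B ω * C ω * D ω * A ω ∂P = ∫ ω, A ω * B ω * C ω * D ω ∂P :=
    integral_congr_ae (.of_forall fun ω => by simp only; ring)
  have hc (X Y : Ω → ℂ) : ∫ ω, X ω * Y ω ∂P = ∫ ω, Y ω * X ω ∂P := by simp only [mul_comm]
  rw [WickFormula] at h ⊢
  rw [h1, h, hc D A, hc C A, hc B A]
  ring

theorem WickFormula.add_const_mul [IsFiniteMeasure P] {R S B C D : Ω → ℂ} (hR : MemLp R 4 P)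
    (hS : MemLp S 4 P) (hB : MemLp B 4 P) (hC : MemLp C 4 P) (hD : MemLp D 4 P)
    (h1 : WickFormula P R B C D) (h2 : WickFormula P S B C D) (c : ℂ) :
    WickFormula P (fun ω => R ω + c * S ω) B C D := by
  have h4 : ∫ ω, (R ω + c * S ω) * B ω * C ω * D ω ∂P =
      ∫ ω, R ω * B ω * C ω * D ω ∂P + c * ∫ ω, S ω * B ω * C ω * D ω ∂P := by
    rw [← integral_const_mul, ← integral_add (integrable_mul_four hR hB hC hD)
      ((integrable_mul_four hS hB hC hD).const_mul c)]
    exact integral_congr_ae (.of_forall fun ω => by simp only; ring)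
  have h3 {Y : Ω → ℂ} (hY : MemLp Y 4 P) : ∫ ω, (R ω + c * S ω) * Y ω ∂P =
      ∫ ω, R ω * Y ω ∂P + c * ∫ ω, S ω * Y ω ∂P := by
    rw [← integral_const_mul, ← integral_add (integrable_mul_two hR hY)
      ((integrable_mul_two hS hY).const_mul c)]
    exact integral_congr_ae (.of_forall fun ω => by simp only; ring)
  rw [WickFormula] at h1 h2 ⊢
  rw [h4, h3 hB, h3 hC, h3 hD, h1, h2]
  ring

/-- If the Wick formula holds on a family of variables, it holds for its linear combinations. -/
theorem WickFormula.of_linearCombination [IsFiniteMeasure P] {T : Type*} {X : T → Ω → ℂ}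
    (hX : ∀ t, MemLp (X t) 4 P) (h : ∀ a b c d, WickFormula P (X a) (X b) (X c) (X d))
    (r s : Fin 4 → T) (z : Fin 4 → ℂ) :
    WickFormula P (fun ω => X (r 0) ω + z 0 * X (s 0) ω) (fun ω => X (r 1) ω + z 1 * X (s 1) ω)
      (fun ω => X (r 2) ω + z 2 * X (s 2) ω) (fun ω => X (r 3) ω + z 3 * X (s 3) ω) := by
  have hZ (i : Fin 4) : MemLp (fun ω => X (r i) ω + z i * X (s i) ω) 4 P :=
    (hX _).add ((hX _).const_mul _)
  -- Each round replaces the first slot by a linear combination and moves it to the back; four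
  -- rounds restore the order.
  have h0 (b c d : T) :=
    (WickFormula.add_const_mul (hX (r 0)) (hX (s 0)) (hX b) (hX c) (hX d) (h _ b c d) (h _ b c d)
      (z 0)).rotate
  have h1 (c d : T) :=
    (WickFormula.add_const_mul (hX (r 1)) (hX (s 1)) (hX c) (hX d) (hZ 0) (h0 _ c d) (h0 _ c d)
      (z 1)).rotate
  have h2 (d : T) :=
    (WickFormula.add_const_mul (hX (r 2)) (hX (s 2)) (hX d) (hZ 0) (hZ 1) (h1 _ d) (h1 _ d)
      (z 2)).rotate
  exact (WickFormula.add_const_mul (hX (r 3)) (hX (s 3)) (hZ 0) (hZ 1) (hZ 2) (h2 _) (h2 _)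
    (z 3)).rotate

end Isserlis

/-! ### Bounded maps from Gram matrices, and centering in `L²`. -/

section Gram

/-- Two families of vectors of Hilbert spaces with the same Gram matrix are related by a
continuous linear map. -/
theorem exists_clm_of_inner_eq {ι K H : Type*} [NormedAddCommGroup K] [InnerProductSpace ℂ K]
    [CompleteSpace K] [NormedAddCommGroup H] [InnerProductSpace ℂ H] [CompleteSpace H]
    (a : ι → K) (x : ι → H) (h : ∀ i j, inner ℂ (x i) (x j) = inner ℂ (a i) (a j)) :
    ∃ T : K →L[ℂ] H, ∀ i, T (a i) = x i := by
  set f := Finsupp.linearCombination ℂ x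
  set g := Finsupp.linearCombination ℂ a
  have hn (c : ι →₀ ℂ) : ‖f c‖ ≤ 1 * ‖g c‖ := by
    rw [one_mul, ← sq_le_sq₀ (norm_nonneg _) (norm_nonneg _)]
    refine le_of_eq ?_
    have h1 : inner ℂ (f c) (f c) = inner ℂ (g c) (g c) := by
      simp only [f, g, Finsupp.linearCombination_apply, Finsupp.sum, sum_inner, inner_sum,
        inner_smul_left, inner_smul_right, h]
    rw [inner_self_eq_norm_sq_to_K, inner_self_eq_norm_sq_to_K] at h1
    exact_mod_cast h1
  set M := (LinearMap.range g).topologicalClosure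
  have : CompleteSpace M := (Submodule.isClosed_topologicalClosure _).completeSpace_coe
  set e : (ι →₀ ℂ) →ₗ[ℂ] M :=
    g.codRestrict M fun c => Submodule.le_topologicalClosure _ (LinearMap.mem_range_self g c)
  have he : DenseRange e := by
    intro y
    rw [Metric.mem_closure_iff]
    intro ε hε
    obtain ⟨_, ⟨c, rfl⟩, hc⟩ := Metric.mem_closure_iff.1 y.2 ε hε
    exact ⟨_, ⟨c, rfl⟩, hc⟩
  -- By `hn` the assignment `g c ↦ f c` is well defined and bounded. It extends to the closed span
  -- `M` of the `a i`, and the orthogonal projection onto `M` extends it to `K`.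
  refine ⟨(f.extendOfNorm e).comp M.orthogonalProjectionOnto, fun i => ?_⟩
  have h1 : M.orthogonalProjectionOnto (a i) = e (Finsupp.single i 1) := by
    have h2 : ((e (Finsupp.single i 1) : M) : K) = a i := by simp [e, g]
    rw [← h2, Submodule.orthogonalProjectionOnto_mem_subspace_eq_self]
  rw [ContinuousLinearMap.comp_apply, h1, LinearMap.extendOfNorm_eq he ⟨1, hn⟩]
  simp [f]

variable {Ω : Type*} [MeasurableSpace Ω] {P : Measure Ω} [IsProbabilityMeasure P]

theorem inner_const_one (X : Lp ℂ 2 P) : inner ℂ (Lp.const 2 P (1 : ℂ)) X = expect P X := rfl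

theorem constL_eq_smul (c : ℂ) : Lp.constL 2 P ℂ c = c • Lp.const 2 P (1 : ℂ) := by
  have h := (Lp.constL 2 P ℂ).map_smul c (1 : ℂ)
  rw [smul_eq_mul, mul_one] at h
  exact h

theorem expect_const_one : expect P (Lp.const 2 P (1 : ℂ)) = 1 := by
  rw [expect_apply, integral_congr_ae (Lp.coeFn_const (p := 2) (μ := P) (1 : ℂ))]
  simp

theorem inner_sub_expect (X Y : Lp ℂ 2 P) :
    inner ℂ (X - Lp.constL 2 P ℂ (expect P X)) (Y - Lp.constL 2 P ℂ (expect P Y)) =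
      inner ℂ X Y - conj (expect P X) * expect P Y := by
  have h1 : inner ℂ X (Lp.const 2 P (1 : ℂ)) = conj (expect P X) := by
    rw [← inner_const_one, inner_conj_symm]
  simp only [constL_eq_smul, inner_sub_left, inner_sub_right, inner_smul_left, inner_smul_right,
    inner_const_one, expect_const_one, h1]
  ring

end Gram

/-! ### Covariances of the products `(u, φ) conj (u, ψ)`. -/

section GaussianSquare

open ProbabilityTheory

variable {V : Type} [NormedAddCommGroup V] [InnerProductSpace ℝ V] [FiniteDimensional ℝ V]
  [MeasurableSpace V] [BorelSpace V]
  {Ω : Type*} [MeasurableSpace Ω] {P : Measure Ω} [IsProbabilityMeasure P]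

/-- Test `μ = (2π)^{n/2} ĥ` on the Fourier transform of `φ * ψ^*`, which is `(2π)^{n/2} φ̂ conj ψ̂`;
the constants cancel. -/
theorem covOp_eq_integral {u : GSP V P} {μ : Measure V} [μ.HasTemperateGrowth]
    (hμ : IsSpectralMeasure u μ) (φ ψ : 𝓢(V, ℂ)) :
    covOp u ψ φ = ∫ ξ, conj (fourierS φ ξ) * fourierS ψ ξ ∂μ := by
  obtain ⟨h, h1, h2⟩ := hμ
  have h3 := DFunLike.congr_fun h2 (fourierS (convS φ (starS ψ)))
  rw [TD.ofMeasure_apply, smul_apply, smul_eq_mul, TD.fourier,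
    ContinuousLinearMap.comp_apply, fourierInvS_fourierS, ← h1] at h3
  simp only [fourierS_convS, fourierS_starS, map_mul, Complex.conj_conj, conj_twoPiPow,
    mul_assoc, integral_const_mul] at h3
  exact (mul_left_cancel₀ twoPiPow_ne_zero h3).symm

theorem memLp_four {u : GSP V P} (hgauss : IsGaussianGSP u) (φ : 𝓢(V, ℂ)) :
    MemLp (fun ω => u φ ω) 4 P :=
  (IsGaussianProcess.hasGaussianLaw_eval hgauss φ).memLp (by norm_num)

theorem memLp_four_conj {u : GSP V P} (hgauss : IsGaussianGSP u) (φ : 𝓢(V, ℂ)) :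
    MemLp (fun ω => conj (u φ ω)) 4 P :=
  (memLp_four hgauss φ).star

/-- The variable `(u, φ)` has vanishing pseudo-covariances for symmetric `u`. -/
theorem integral_mul_eq_zero {u : GSP V P} (hsym : IsSymmetricGSP u) (φ ψ : 𝓢(V, ℂ)) :
    ∫ ω, u φ ω * u ψ ω ∂P = 0 := by
  -- Multiplying `u` by `i` preserves the joint law but multiplies the product by `i² = -1`.
  have h := hsym Complex.I (by simp) 2 ![φ, ψ]
  have hm (f : 𝓢(V, ℂ)) : AEMeasurable (fun ω => u f ω) P :=
    (Lp.aestronglyMeasurable (u f)).aemeasurable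
  have hg : AEStronglyMeasurable (fun z : Fin 2 → ℂ => z 0 * z 1)
      (P.map fun ω i => u (![φ, ψ] i) ω) := Continuous.aestronglyMeasurable (by fun_prop)
  have h1 := integral_map (aemeasurable_pi_lambda _ fun i => hm (![φ, ψ] i)) hg
  have h2 := integral_map (aemeasurable_pi_lambda _ fun i => (hm (![φ, ψ] i)).const_mul Complex.I)
    (h ▸ hg)
  rw [h, h1] at h2
  simp only [Matrix.cons_val_zero, Matrix.cons_val_one] at h2
  have h3 : ∫ ω, Complex.I * u φ ω * (Complex.I * u ψ ω) ∂P = -∫ ω, u φ ω * u ψ ω ∂P := by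
    rw [← integral_neg]
    refine integral_congr_ae (.of_forall fun ω => ?_)
    simp only
    linear_combination (u φ ω * u ψ ω) * Complex.I_mul_I
  rw [h3] at h2
  exact self_eq_neg.1 h2

/-- The real (`false`) and imaginary (`true`) parts of the variables `(u, φ)`. -/
def realPart (u : GSP V P) (t : 𝓢(V, ℂ) × Bool) (ω : Ω) : ℝ :=
  cond t.2 (u t.1 ω).im (u t.1 ω).re

theorem isGaussianProcess_realPart {u : GSP V P} (hgauss : IsGaussianGSP u) :
    IsGaussianProcess (realPart u) P := by
  have h1 := IsGaussianProcess.comp_right hgauss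
    (Prod.fst : 𝓢(V, ℂ) × Bool → 𝓢(V, ℂ))
  have h2 := h1.comp_left fun t => cond t.2 Complex.imCLM Complex.reCLM
  have h3 : realPart u = fun t ω => (cond t.2 Complex.imCLM Complex.reCLM : ℂ →L[ℝ] ℝ)
      (u t.1 ω) := by
    funext t ω
    obtain ⟨φ, b⟩ := t
    cases b <;> rfl
  rw [h3]
  exact h2

theorem integral_realPart {u : GSP V P} (hzero : mean u = 0) (hgauss : IsGaussianGSP u)
    (t : 𝓢(V, ℂ) × Bool) : ∫ ω, realPart u t ω ∂P = 0 := by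
  have hi : Integrable (fun ω => u t.1 ω) P :=
    (memLp_four hgauss t.1).integrable (by norm_num)
  have h0 : ∫ ω, u t.1 ω ∂P = 0 := by
    rw [← expect_apply]
    exact DFunLike.congr_fun hzero t.1
  obtain ⟨φ, b⟩ := t
  cases b
  · exact (integral_re hi).trans (by rw [h0]; rfl)
  · exact (integral_im hi).trans (by rw [h0]; rfl)

theorem wickFormula_realPart {u : GSP V P} (hzero : mean u = 0) (hgauss : IsGaussianGSP u)
    (a b c d : 𝓢(V, ℂ) × Bool) :
    WickFormula P (fun ω => (realPart u a ω : ℂ)) (fun ω => (realPart u b ω : ℂ))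
      (fun ω => (realPart u c ω : ℂ)) (fun ω => (realPart u d ω : ℂ)) := by
  have h := isserlis_real ((isGaussianProcess_realPart hgauss).comp_right ![a, b, c, d])
    fun i => integral_realPart hzero hgauss _
  simp only [Function.comp_apply, Matrix.cons_val] at h
  rw [WickFormula]
  simp only [← Complex.ofReal_mul, integral_complex_ofReal]
  exact_mod_cast h

theorem wickFormula_conj_self_self_conj {u : GSP V P} (hzero : mean u = 0)
    (hgauss : IsGaussianGSP u) (φ₁ φ₂ φ₃ φ₄ : 𝓢(V, ℂ)) :
    WickFormula P (fun ω => conj (u φ₁ ω)) (fun ω => u φ₂ ω) (fun ω => u φ₃ ω)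
      (fun ω => conj (u φ₄ ω)) := by
  have h := WickFormula.of_linearCombination
    (fun t => (memLp_four_of_isGaussianProcess (isGaussianProcess_realPart hgauss) t).ofReal
      (K := ℂ))
    (wickFormula_realPart hzero hgauss)
    ![(φ₁, false), (φ₂, false), (φ₃, false), (φ₄, false)]
    ![(φ₁, true), (φ₂, true), (φ₃, true), (φ₄, true)]
    -- The coefficient is `i` for `(u, φ) = Re + i Im`, and `-i` in the two conjugated slots.
    ![-Complex.I, Complex.I, Complex.I, -Complex.I]
  have h1 (φ : 𝓢(V, ℂ)) : (fun ω => u φ ω) = fun ω => (realPart u (φ, false) ω : ℂ) +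
      Complex.I * (realPart u (φ, true) ω : ℂ) := funext fun ω => by
    rw [mul_comm]
    exact (Complex.re_add_im _).symm
  have h2 (φ : 𝓢(V, ℂ)) : (fun ω => conj (u φ ω)) = fun ω => (realPart u (φ, false) ω : ℂ) +
      -Complex.I * (realPart u (φ, true) ω : ℂ) := funext fun ω => by
    rw [congrFun (h1 φ) ω]
    simp
  rw [h1, h1, h2, h2]
  exact h

/-- The variable `(u, φ) conj (u, ψ)`. -/
def productVar {u : GSP V P} (hgauss : IsGaussianGSP u) (φ ψ : 𝓢(V, ℂ)) : Lp ℂ 2 P :=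
  (memLp_two_mul (memLp_four hgauss φ) (memLp_four_conj hgauss ψ)).toLp _

theorem coeFn_productVar {u : GSP V P} (hgauss : IsGaussianGSP u) (φ ψ : 𝓢(V, ℂ)) :
    productVar hgauss φ ψ =ᵐ[P] fun ω => u φ ω * conj (u ψ ω) :=
  MemLp.coeFn_toLp _

theorem expect_productVar {u : GSP V P} (hgauss : IsGaussianGSP u) (φ ψ : 𝓢(V, ℂ)) :
    expect P (productVar hgauss φ ψ) = covOp u ψ φ := by
  rw [expect_apply, covOp_apply, integral_congr_ae (coeFn_productVar hgauss φ ψ)]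

/-- Of the three Wick pairings, the one matching the two conjugated variables with each other
vanishes by symmetry. -/
theorem inner_productVar {u : GSP V P} (hzero : mean u = 0) (hsym : IsSymmetricGSP u)
    (hgauss : IsGaussianGSP u) (φ ψ φ' ψ' : 𝓢(V, ℂ)) :
    inner ℂ (productVar hgauss φ ψ) (productVar hgauss φ' ψ') =
      covOp u φ ψ * covOp u ψ' φ' + covOp u φ φ' * covOp u ψ' ψ := by
  have h1 : inner ℂ (productVar hgauss φ ψ) (productVar hgauss φ' ψ') =
      ∫ ω, conj (u φ ω) * u ψ ω * u φ' ω * conj (u ψ' ω) ∂P := by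
    rw [L2.inner_def]
    refine integral_congr_ae ?_
    filter_upwards [coeFn_productVar hgauss φ ψ, coeFn_productVar hgauss φ' ψ'] with ω h h'
    rw [h, h', RCLike.inner_apply, map_mul, Complex.conj_conj]
    ring
  have h2 : ∫ ω, conj (u φ ω) * conj (u ψ' ω) ∂P = 0 := by
    rw [← map_zero conj, ← integral_mul_eq_zero hsym φ ψ', ← integral_conj]
    exact integral_congr_ae (.of_forall fun ω => (map_mul conj _ _).symm)
  have h3 (f g : 𝓢(V, ℂ)) : ∫ ω, conj (u f ω) * u g ω ∂P = covOp u f g := by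
    rw [covOp_apply]
    exact integral_congr_ae (.of_forall fun ω => mul_comm _ _)
  have hw : ∫ ω, conj (u φ ω) * u ψ ω * u φ' ω * conj (u ψ' ω) ∂P = _ :=
    wickFormula_conj_self_self_conj hzero hgauss φ ψ φ' ψ'
  rw [h1, hw, h2, zero_mul, add_zero, h3, h3, covOp_apply u ψ' φ', covOp_apply u ψ' ψ]

/-- Centering cancels exactly the pairing within each product, leaving the cross pairing. -/
theorem inner_productVar_sub_expect {u : GSP V P} (hzero : mean u = 0) (hsym : IsSymmetricGSP u)
    (hgauss : IsGaussianGSP u) (φ ψ φ' ψ' : 𝓢(V, ℂ)) :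
    inner ℂ (productVar hgauss φ ψ - Lp.constL 2 P ℂ (expect P (productVar hgauss φ ψ)))
      (productVar hgauss φ' ψ' - Lp.constL 2 P ℂ (expect P (productVar hgauss φ' ψ'))) =
      covOp u φ φ' * covOp u ψ' ψ := by
  have h : conj (covOp u ψ φ) = covOp u φ ψ := by
    rw [covOp_apply, covOp_apply, ← integral_conj]
    refine integral_congr_ae (.of_forall fun ω => ?_)
    simp [mul_comm]
  rw [inner_sub_expect, inner_productVar hzero hsym, expect_productVar, expect_productVar, h]
  ring

end GaussianSquare

/-! ### The mean as a diagonal restriction, and the antilinear spectral map. -/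

section MeanDistribution

variable {V : Type} [NormedAddCommGroup V] [InnerProductSpace ℝ V] [FiniteDimensional ℝ V]
  [MeasurableSpace V] [BorelSpace V]

/-- The diagonal embedding does not shrink distances, so restriction to it preserves Schwartz decay.
-/
theorem antilipschitzWith_pt_self : AntilipschitzWith 1 fun ξ : V => (pt ξ ξ : Phase V) := by
  refine AntilipschitzWith.of_le_mul_dist fun x y => ?_
  rw [NNReal.coe_one, one_mul, dist_eq_norm, dist_eq_norm]
  exact WithLp.norm_fst_le _ (pt x x - pt y y : Phase V)

variable (V) in
/-- Restriction of a Schwartz function to the diagonal. -/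
def diagonalRestriction : 𝓢(Phase V, ℂ) →L[ℂ] 𝓢(V, ℂ) :=
  compCLMOfAntilipschitz ℂ (g := fun ξ : V => (pt ξ ξ : Phase V))
    (((WithLp.prodContinuousLinearEquiv 2 ℝ V V).symm : V × V →L[ℝ] Phase V).comp
      ((ContinuousLinearMap.id ℝ V).prod (ContinuousLinearMap.id ℝ V))).hasTemperateGrowth
    antilipschitzWith_pt_self

/-- The mean of `u ⊗ conj u` for a process `u` with spectral measure `μ`. -/
def meanTD (μ : Measure V) [μ.HasTemperateGrowth] : TD (Phase V) :=
  (TD.ofMeasure μ).comp ((diagonalRestriction V).comp reflectedFourier)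

theorem meanTD_apply (μ : Measure V) [μ.HasTemperateGrowth] (F : 𝓢(Phase V, ℂ)) :
    meanTD μ F = ∫ ξ, conj (reflectedFourier F (pt ξ ξ)) ∂μ :=
  TD.ofMeasure_apply _ _

theorem meanTD_tensor (μ : Measure V) [μ.HasTemperateGrowth] (φ ψ : 𝓢(V, ℂ)) :
    meanTD μ (tensor φ (conjS ψ)) = ∫ ξ, conj (fourierS φ ξ) * fourierS ψ ξ ∂μ := by
  simp only [meanTD_apply, reflectedFourier_tensor, map_mul, Complex.conj_conj]

/-- At `ξ = η` the exponential is `1` and the midpoint is `ξ`, so only the integral of `Φ(x, ξ)`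
over `x` remains. -/
theorem meanTD_wignerPullback (μ : Measure V) [μ.HasTemperateGrowth] (Φ : 𝓢(Phase V, ℂ)) :
    meanTD μ (wignerPullback V Φ) =
      (twoPiPow V)⁻¹ * TD.ofMeasure (prodMeasure volume μ) Φ := by
  have := sigmaFinite_of_hasTemperateGrowth μ
  have hi : Integrable (fun p : V × V => Φ (pt p.1 p.2)) ((volume : Measure V).prod μ) :=
    (measurePreserving_pt (volume : Measure V) μ).integrable_comp_of_integrable
      (Φ.integrable (μ := prodMeasure volume μ))
  rw [TD.ofMeasure_apply, integral_conj, integral_prodMeasure, integral_prod_symm _ hi, meanTD_apply,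
    ← integral_conj, ← integral_const_mul]
  refine integral_congr_ae (.of_forall fun ξ => ?_)
  have h : (1 / 2 : ℝ) • (ξ + ξ) = ξ := by module
  simp only [reflectedFourier_wignerPullback, h, sub_self, inner_zero_right, Complex.ofReal_zero,
    mul_zero, neg_zero, Complex.exp_zero, mul_one, map_mul, map_inv₀, conj_twoPiPow]

/-- The conjugate of `spectralMap`. -/
def conjSpectralMap (μ : Measure V) [μ.HasTemperateGrowth] :
    𝓢(Phase V, ℂ) →L⋆[ℂ] Lp ℂ 2 (prodMeasure μ μ) :=
  (toLpCLM ℂ ℂ 2 (prodMeasure μ μ)).comp ((conjL (Phase V)).comp reflectedFourier)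

/-- Processes are antilinear in the test function, so `U` must factor through the conjugated map;
conjugation swaps the arguments of the inner product. -/
theorem inner_conjSpectralMap (μ : Measure V) [μ.HasTemperateGrowth] (F G : 𝓢(Phase V, ℂ)) :
    inner ℂ (conjSpectralMap μ F) (conjSpectralMap μ G) =
      inner ℂ (spectralMap μ G) (spectralMap μ F) := by
  refine (inner_toL2_toL2_eq (conjS (reflectedFourier F)) (conjS (reflectedFourier G))
    (prodMeasure μ μ)).trans (Eq.trans ?_
      (inner_toL2_toL2_eq (reflectedFourier G) (reflectedFourier F) (prodMeasure μ μ)).symm)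
  refine integral_congr_ae (.of_forall fun z => ?_)
  simp only [RCLike.inner_apply, conjS_apply, Complex.conj_conj]
  ring

end MeanDistribution

/-! ### Existence and uniqueness of `u ⊗ conj u`, its Wigner mean and its Weyl symbol. -/

section TensorSquare

variable {V : Type} [NormedAddCommGroup V] [InnerProductSpace ℝ V] [FiniteDimensional ℝ V]
  [MeasurableSpace V] [BorelSpace V]
  {Ω : Type*} [MeasurableSpace Ω] {P : Measure Ω} [IsProbabilityMeasure P]
  {u : GSP V P} {U : GSP (Phase V) P} {μ : Measure V} [μ.HasTemperateGrowth]

theorem isTensorSquare_iff (hgauss : IsGaussianGSP u) :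
    IsTensorSquare u U ↔ ∀ φ ψ : 𝓢(V, ℂ), U (tensor φ (conjS ψ)) = productVar hgauss φ ψ := by
  refine forall₂_congr fun φ ψ => ⟨fun h => ?_, fun h => ?_⟩
  · exact Lp.ext (h.trans (coeFn_productVar hgauss φ ψ).symm)
  · rw [h]
    exact coeFn_productVar hgauss φ ψ

theorem IsTensorSquare.mean_eq (hU : IsTensorSquare u U) (hgauss : IsGaussianGSP u)
    (hμ : IsSpectralMeasure u μ) : mean U = meanTD μ := by
  refine ext_of_tensor fun φ ψ => ?_
  rw [mean, ContinuousLinearMap.comp_apply, (isTensorSquare_iff hgauss).1 hU,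
    expect_productVar hgauss, covOp_eq_integral hμ, meanTD_tensor]

theorem IsTensorSquare.eq {U' : GSP (Phase V) P} (hU : IsTensorSquare u U)
    (hU' : IsTensorSquare u U') : U = U' :=
  ext_of_tensor fun φ ψ => Lp.ext ((hU φ ψ).trans (hU' φ ψ).symm)

theorem inner_productVar_sub_expect_eq (hzero : mean u = 0) (hsym : IsSymmetricGSP u)
    (hgauss : IsGaussianGSP u) (hμ : IsSpectralMeasure u μ) (φ ψ φ' ψ' : 𝓢(V, ℂ)) :
    inner ℂ (productVar hgauss φ ψ - Lp.constL 2 P ℂ (expect P (productVar hgauss φ ψ)))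
      (productVar hgauss φ' ψ' - Lp.constL 2 P ℂ (expect P (productVar hgauss φ' ψ'))) =
      inner ℂ (spectralMap μ (tensor φ' (conjS ψ'))) (spectralMap μ (tensor φ (conjS ψ))) := by
  rw [inner_productVar_sub_expect hzero hsym, inner_spectralMap_tensor, covOp_eq_integral hμ,
    covOp_eq_integral hμ]

/-- The centered products and the vectors `conjSpectralMap μ (φ ⊗ conj ψ)` have the same Gram
matrix. The bounded map between them makes the centered process continuous, and `meanTD μ` supplies
the mean. -/
theorem exists_isTensorSquare (hzero : mean u = 0) (hsym : IsSymmetricGSP u)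
    (hgauss : IsGaussianGSP u) (hμ : IsSpectralMeasure u μ) :
    ∃ U : GSP (Phase V) P, IsTensorSquare u U := by
  obtain ⟨T, hT⟩ := exists_clm_of_inner_eq
    (fun p : 𝓢(V, ℂ) × 𝓢(V, ℂ) => conjSpectralMap μ (tensor p.1 (conjS p.2)))
    (fun p => productVar hgauss p.1 p.2 -
      Lp.constL 2 P ℂ (expect P (productVar hgauss p.1 p.2)))
    fun p q => by
      rw [inner_conjSpectralMap, inner_productVar_sub_expect_eq hzero hsym hgauss hμ]
  refine ⟨T.comp (conjSpectralMap μ) + (Lp.constL 2 P ℂ).comp (meanTD μ),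
    (isTensorSquare_iff hgauss).2 fun φ ψ => ?_⟩
  rw [add_apply, ContinuousLinearMap.comp_apply, ContinuousLinearMap.comp_apply, hT (φ, ψ),
    meanTD_tensor, ← covOp_eq_integral hμ, expect_productVar hgauss, sub_add_cancel]

/-- The Gram identity on tensors extends to all Schwartz functions by density, first in the second
argument and then in the first. -/
theorem IsTensorSquare.inner_centered (hU : IsTensorSquare u U) (hzero : mean u = 0)
    (hsym : IsSymmetricGSP u) (hgauss : IsGaussianGSP u) (hμ : IsSpectralMeasure u μ)
    (F G : 𝓢(Phase V, ℂ)) :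
    inner ℂ (centered U F) (centered U G) = inner ℂ (spectralMap μ G) (spectralMap μ F) := by
  have ht (φ ψ : 𝓢(V, ℂ)) : centered U (tensor φ (conjS ψ)) =
      productVar hgauss φ ψ - Lp.constL 2 P ℂ (expect P (productVar hgauss φ ψ)) := by
    rw [← (isTensorSquare_iff hgauss).1 hU]
    rfl
  have h1 (φ ψ : 𝓢(V, ℂ)) : (innerSL ℂ (centered U (tensor φ (conjS ψ)))).comp (centered U) =
      (innerSL ℂ (conjSpectralMap μ (tensor φ (conjS ψ)))).comp (conjSpectralMap μ) :=
    ext_of_tensor fun φ' ψ' => by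
      simp only [ContinuousLinearMap.comp_apply, innerSL_apply_apply, ht, inner_conjSpectralMap]
      exact inner_productVar_sub_expect_eq hzero hsym hgauss hμ φ ψ φ' ψ'
  have h2 : (innerSLFlip ℂ (centered U G)).comp (centered U) =
      (innerSLFlip ℂ (conjSpectralMap μ G)).comp (conjSpectralMap μ) :=
    ext_of_tensor fun φ ψ => DFunLike.congr_fun (h1 φ ψ) G
  exact (DFunLike.congr_fun h2 F).trans (inner_conjSpectralMap μ F G)

theorem IsTensorSquare.mean_wigner (hU : IsTensorSquare u U) (hgauss : IsGaussianGSP u)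
    (hμ : IsSpectralMeasure u μ) :
    mean (wigner U) = (twoPiPow V)⁻¹ • TD.ofMeasure (prodMeasure volume μ) := by
  ext Φ
  exact (DFunLike.congr_fun (hU.mean_eq hgauss hμ) (wignerPullback V Φ)).trans
    (meanTD_wignerPullback μ Φ)

/-- The covariance and the symbol pairing are the same `L²(μ ⊗ μ)` inner product of Wigner
pullbacks; the factor `twoPiPow (Phase V)` cancels the one in the Weyl calculus. -/
theorem IsTensorSquare.isWeylSymbol (hU : IsTensorSquare u U) (hzero : mean u = 0)
    (hsym : IsSymmetricGSP u) (hgauss : IsGaussianGSP u) (hμ : IsSpectralMeasure u μ) :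
    IsWeylSymbol (covOp (wigner (centered U))) (symbolTD μ) := by
  intro f g
  rw [symbolTD_crossWigner, inv_mul_cancel_left₀ twoPiPow_ne_zero]
  exact hU.inner_centered hzero hsym hgauss hμ (wignerPullback V f) (wignerPullback V g)

theorem IsWeylSymbol.eq {K : 𝓢(V, ℂ) → TD V} {σ τ : TD (Phase V)} (hσ : IsWeylSymbol K σ)
    (hτ : IsWeylSymbol K τ) : σ = τ :=
  ext_of_crossWigner fun g f =>
    mul_left_cancel₀ (inv_ne_zero twoPiPow_ne_zero) ((hσ f g).symm.trans (hτ f g))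

end TensorSquare

end WignerProcess

end

theorem proposition6p1 {d : ℕ} {Ω : Type*} [MeasurableSpace Ω] {P : Measure Ω}
    [IsProbabilityMeasure P] (u : GSP (EuclideanSpace ℝ (Fin d)) P)
    (hzero : mean u = 0) (hsym : IsSymmetricGSP u) (hgauss : IsGaussianGSP u)
    (hstat : IsStationaryGSP u) (μ : Measure (EuclideanSpace ℝ (Fin d)))
    [μ.HasTemperateGrowth] (hμ : IsSpectralMeasure u μ) :
    (∃! U : GSP (Phase (EuclideanSpace ℝ (Fin d))) P, IsTensorSquare u U) ∧
    ∀ U : GSP (Phase (EuclideanSpace ℝ (Fin d))) P, IsTensorSquare u U →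
      mean (wigner U) =
        (((2 * Real.pi) ^ (-(d : ℝ) / 2) : ℝ) : ℂ) • TD.ofMeasure (prodMeasure volume μ) ∧
      (∃! σ : TD (Phase (Phase (EuclideanSpace ℝ (Fin d)))),
        IsWeylSymbol (covOp (wigner (centered U))) σ) ∧
      ∀ σ : TD (Phase (Phase (EuclideanSpace ℝ (Fin d)))),
        IsWeylSymbol (covOp (wigner (centered U))) σ →
        σ = TD.compLinear
          (TD.ofMeasure (prodMeasure (prodMeasure volume μ) (prodMeasure μ volume)))
          (symbolMap (EuclideanSpace ℝ (Fin d))) := by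
  refine ⟨?_, fun U hU => ⟨?_, ?_, fun σ hσ => ?_⟩⟩
  · obtain ⟨U, hU⟩ := exists_isTensorSquare hzero hsym hgauss hμ
    exact ⟨U, hU, fun U' hU' => IsTensorSquare.eq hU' hU⟩
  · rw [hU.mean_wigner hgauss hμ, twoPiPow, finrank_euclideanSpace_fin, ← Complex.ofReal_inv,
      ← Real.rpow_neg (by positivity), neg_div]
  · exact ⟨_, hU.isWeylSymbol hzero hsym hgauss hμ,
      fun σ hσ => hσ.eq (hU.isWeylSymbol hzero hsym hgauss hμ)⟩
  · exact hσ.eq (hU.isWeylSymbol hzero hsym hgauss hμ)
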